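/- Let $\mathcal T_{0,n}$ be the (finite) set of labelled plane trees with $n$ edges, that is, rooted ordered trees with $n$ edges whose nodes carry integer labels such that the root has label $0$ and the labels of any two adjacent nodes differ by $1$ or $-1$. Endow $\mathcal T_{0,n}$ with the uniform distribution, and for $j\in\mathbb Z$ let $X_n(j)$ be the number of nodes with label $j$ in a random tree of $\mathcal T_{0,n}$. Let $\lambda\in\mathbb R$ and, for each $n$, put $j=\lfloor \lambda n^{1/4}\rfloor$. Then, as $n\to\infty$, $$\mathbb E\!\left(\frac{X_n(j)}{n^{3/4}}\right)\longrightarrow \frac{1}{\sqrt{\pi}}\sum_{m\ge 0}\frac{(-2|\lambda|)^m}{m!}\cos\!\left(\frac{(m+1)\pi}{4}\right)\Gamma\!\left(\frac{m+3}{4}\right),$$ where the series on the right converges absolutely. -/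

import Mathlib

open MeasureTheory ProbabilityTheory Filter Topology

namespace EmbeddedTrees

/-- Finite plane (rooted, ordered) trees whose nodes carry integer labels: a node is given by its
label and by the ordered list of the subtrees attached to it. -/
inductive LabelledTree : Type
  | node (label : ℤ) (children : List LabelledTree) : LabelledTree

namespace LabelledTree

/-- The label of the root. -/
def rootLabel : LabelledTree → ℤ
  | node l _ => l

mutual
/-- The number of edges of a tree. -/
def edges : LabelledTree → ℕ
  | node _ cs => edgesBelow cs
/-- The number of edges contributed by a list of subtrees attached to a common node (each subtree
contributes its own edges and the edge that joins its root to the common node). -/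
def edgesBelow : List LabelledTree → ℕ
  | [] => 0
  | c :: cs => (edges c + 1) + edgesBelow cs
end

mutual
/-- The number of nodes of a tree that have label `j`. -/
def nodesLabelled (j : ℤ) : LabelledTree → ℕ
  | node l cs => (if l = j then 1 else 0) + nodesLabelledBelow j cs
/-- The total number of nodes that have label `j` in a list of trees. -/
def nodesLabelledBelow (j : ℤ) : List LabelledTree → ℕ
  | [] => 0
  | c :: cs => nodesLabelled j c + nodesLabelledBelow j cs
end

/-- The labels of any two adjacent nodes differ by `1` or `-1`. -/
inductive HasUnitIncrements : LabelledTree → Prop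
  | node (l : ℤ) (cs : List LabelledTree)
      (hroot : ∀ c ∈ cs, c.rootLabel = l + 1 ∨ c.rootLabel = l - 1)
      (hsub : ∀ c ∈ cs, HasUnitIncrements c) : HasUnitIncrements (node l cs)

/-- Every set of labelled trees is measurable. -/
instance : MeasurableSpace LabelledTree := ⊤

end LabelledTree

open LabelledTree

/-- The set of plane trees with `n` edges whose root is labelled `r` and whose labels
differ by `±1` along each edge. -/
def treesFrom (r : ℤ) (n : ℕ) : Set LabelledTree :=
  {τ | τ.rootLabel = r ∧ τ.HasUnitIncrements ∧ τ.edges = n}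

theorem treesFrom_finite (n : ℕ) : ∀ r : ℤ, (treesFrom r n).Finite := by
  induction n using Nat.strong_induction_on with
  | _ n ih =>
    intro r
    let graft : LabelledTree → LabelledTree → LabelledTree := fun c t =>
      match t with
      | node l cs => node l (c :: cs)
    let F : Set LabelledTree := ⋃ a ∈ Set.Iio n, (treesFrom (r + 1) a ∪ treesFrom (r - 1) a)
    let G : Set LabelledTree := ⋃ b ∈ Set.Iio n, treesFrom r b
    have hF : F.Finite := (Set.finite_Iio n).biUnion fun a ha => (ih a ha _).union (ih a ha _)
    have hG : G.Finite := (Set.finite_Iio n).biUnion fun b hb => ih b hb _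
    refine ((Set.finite_singleton (node r [])).union (hF.image2 graft hG)).subset ?_
    rintro ⟨l, cs⟩ ⟨hl, hinc, he⟩
    cases hl
    cases hinc with
    | node _ _ hroot hsub =>
      cases cs with
      | nil => left; rfl
      | cons c cs =>
        right
        simp only [edges, edgesBelow] at he
        refine ⟨c, ?_, node l cs, ?_, rfl⟩
        · simp only [F, Set.mem_iUnion]
          refine ⟨c.edges, Set.mem_Iio.2 (by omega), ?_⟩
          rcases hroot c (by simp) with h | h
          · exact Or.inl ⟨h, hsub c (by simp), rfl⟩
          · exact Or.inr ⟨h, hsub c (by simp), rfl⟩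
        · simp only [G, Set.mem_iUnion]
          refine ⟨edgesBelow cs, Set.mem_Iio.2 (by omega), rfl, ?_, by simp [edges]⟩
          exact .node l cs (fun d hd => hroot d (by simp [hd])) (fun d hd => hsub d (by simp [hd]))

theorem treesFrom_nonempty (n : ℕ) : ∀ r : ℤ, (treesFrom r n).Nonempty := by
  induction n with
  | zero => exact fun r => ⟨node r [], rfl, .node r [] (by simp) (by simp), by simp [edges, edgesBelow]⟩
  | succ n ih =>
    intro r
    obtain ⟨τ, h1, h2, h3⟩ := ih (r + 1)
    exact ⟨node r [τ], rfl, .node r [τ] (by simp [h1]) (by simpa using h2),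
      by simp [edges, edgesBelow, h3]⟩

/-- The uniform distribution on the (finite, nonempty) set of trees with `n` edges, root label `0`
and increments `±1`. -/
noncomputable def treeLaw (n : ℕ) : Measure LabelledTree := uniformOn (treesFrom 0 n)

instance (n : ℕ) : IsProbabilityMeasure (treeLaw n) :=
  isProbabilityMeasure_uniformOn (treesFrom_finite n 0) (treesFrom_nonempty n 0)

/-- The normalized number `X_n(j) / n^{3/4}` of nodes labelled `j`, as a function of the tree. -/
noncomputable def normalizedCount (n : ℕ) (j : ℤ) (τ : LabelledTree) : ℝ :=
  (τ.nodesLabelled j : ℝ) / (n : ℝ) ^ (3 / 4 : ℝ)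

end EmbeddedTrees

-- Cutting off the leftmost subtree gives T = 1 + 2XT² for the tree series T, and a linear
-- recurrence in the root label for the series weighted by nodes labelled j. Following the path from
-- the root to a marked node, the latter unfolds into the sum over k of w_k(j) X^k T^(2k+1), where
-- w_k counts ±1 walks. The coefficients of powers of T are explicit, so the mean number of nodes
-- labelled j is the sum over depths k of (2k+1) C(2n+1, n+1+k) / C(2n+1, n+1) · P(S_k = j), with S
-- simple random walk (`totalNodes_div_card`).
--
-- With q = n^(1/4), k ≈ q²x and |j| ≈ |λ|q, the binomial ratio tends to exp(-x²), and the walk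
-- probability, which lives on one parity class, is of order 1/q with profile exp(-λ²/(2x)). Written
-- as the integral of a step function and dominated by a Gaussian, the normalized mean tends to
-- √(2/π) ∫ x^(1/2) exp(-x² - λ²/(2x)) dx over x > 0 (`tendsto_integral_normalizedCount`).
--
-- The integral is matched with the series by an ODE in a = |λ|. Up to constants, the moments of
-- order 1/2 and -1/2 and the rescaled moment of order -3/2 satisfy h' = -k, k' = -2f, f' = -2ah.
-- The cosine-Gamma series satisfy the same system, since differentiation shifts their index by one
-- and Γ(z+1) = zΓ(z) closes the cycle after three steps. The values at 0 agree, so the solutions do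
-- (`dampedMoment_half_eq_cosGammaSeries`).

namespace EmbeddedTrees
open LabelledTree

-- Decomposition of trees at the leftmost subtree

/-- The trees with `n` edges and root label `r`, as a finset. -/
noncomputable def treesFinset (r : ℤ) (n : ℕ) : Finset LabelledTree :=
  (treesFrom_finite n r).toFinset

theorem mem_treesFinset {r : ℤ} {n : ℕ} {τ : LabelledTree} :
    τ ∈ treesFinset r n ↔ τ.rootLabel = r ∧ τ.HasUnitIncrements ∧ τ.edges = n := by
  simp [treesFinset, treesFrom]

/-- Attach a tree as the leftmost subtree of the root of another one. -/
def graft (c : LabelledTree) : LabelledTree → LabelledTree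
  | node l cs => node l (c :: cs)

theorem nodesLabelled_graft (j : ℤ) (c t : LabelledTree) :
    (graft c t).nodesLabelled j = c.nodesLabelled j + t.nodesLabelled j := by
  cases t
  simp only [graft, nodesLabelled, nodesLabelledBelow]
  omega

open Classical in
/-- The pairs of trees whose grafting produces the trees with `n + 1` edges and root label `r`. -/
noncomputable def graftPairs (r : ℤ) (n : ℕ) : Finset (LabelledTree × LabelledTree) :=
  (Finset.HasAntidiagonal.antidiagonal n).biUnion fun p =>
    (treesFinset (r + 1) p.1 ∪ treesFinset (r - 1) p.1) ×ˢ treesFinset r p.2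

theorem mem_graftPairs {r : ℤ} {n : ℕ} {q : LabelledTree × LabelledTree} :
    q ∈ graftPairs r n ↔ (q.1.rootLabel = r + 1 ∨ q.1.rootLabel = r - 1) ∧
      q.1.HasUnitIncrements ∧ q.2.rootLabel = r ∧ q.2.HasUnitIncrements ∧
      q.1.edges + q.2.edges = n := by
  simp only [graftPairs, Finset.mem_biUnion, Finset.HasAntidiagonal.mem_antidiagonal, Finset.mem_product,
    Finset.mem_union, mem_treesFinset]
  constructor
  · rintro ⟨p, hp, h1 | h1, h2⟩ <;> grind
  · rintro ⟨h1, h2, h3, h4, h5⟩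
    exact ⟨(q.1.edges, q.2.edges), h5, by tauto, h3, h4, rfl⟩

/-- Grafting is a bijection: every root with a child has a unique leftmost subtree. The joining edge
accounts for the drop from `n + 1` to `n`. -/
theorem sum_treesFinset_succ_eq_graftPairs (r : ℤ) (n : ℕ) (φ : LabelledTree → ℝ) :
    ∑ τ ∈ treesFinset r (n + 1), φ τ = ∑ q ∈ graftPairs r n, φ (graft q.1 q.2) := by
  symm
  refine Finset.sum_nbij (fun q => graft q.1 q.2) ?_ ?_ ?_ (fun _ _ => rfl)
  · rintro ⟨c, ⟨l, cs⟩⟩ h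
    obtain ⟨h1, h2, h3, h4, h5⟩ := mem_graftPairs.1 h
    cases h4 with
    | node _ _ hr hs =>
      refine mem_treesFinset.2 ⟨h3, .node _ _ ?_ ?_, ?_⟩
      · simp only [List.mem_cons, forall_eq_or_imp]
        simp only [rootLabel] at h3
        exact ⟨by rw [h3]; exact h1, hr⟩
      · simp only [List.mem_cons, forall_eq_or_imp]
        exact ⟨h2, hs⟩
      · simp only [edges, edgesBelow, graft] at h5 ⊢
        omega
  · rintro ⟨c, ⟨l, cs⟩⟩ - ⟨c', ⟨l', cs'⟩⟩ - h
    simp only [graft, node.injEq, List.cons.injEq] at h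
    simp [h]
  · rintro ⟨l, cs⟩ h
    obtain ⟨h1, h2, h3⟩ := mem_treesFinset.1 h
    cases h2 with
    | node _ _ hr hs =>
      cases cs with
      | nil => simp [edges, edgesBelow] at h3
      | cons c cs =>
        refine ⟨(c, node l cs), mem_graftPairs.2 ?_, rfl⟩
        simp only [List.mem_cons, forall_eq_or_imp] at hr hs
        simp only [rootLabel] at h1
        simp only [edges, edgesBelow] at h3 ⊢
        exact ⟨h1 ▸ hr.1, hs.1, h1, .node _ _ hr.2 hs.2, by omega⟩

theorem sum_treesFinset_succ (r : ℤ) (n : ℕ) (φ : LabelledTree → ℝ) :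
    ∑ τ ∈ treesFinset r (n + 1), φ τ = ∑ p ∈ Finset.HasAntidiagonal.antidiagonal n,
      (∑ c ∈ treesFinset (r + 1) p.1, ∑ t ∈ treesFinset r p.2, φ (graft c t) +
        ∑ c ∈ treesFinset (r - 1) p.1, ∑ t ∈ treesFinset r p.2, φ (graft c t)) := by
  classical
  rw [sum_treesFinset_succ_eq_graftPairs, graftPairs, Finset.sum_biUnion]
  · refine Finset.sum_congr rfl fun p _ => ?_
    rw [Finset.sum_product, Finset.sum_union]
    rw [Finset.disjoint_left]
    intro t h1 h2
    have := (mem_treesFinset.1 h1).1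
    have := (mem_treesFinset.1 h2).1
    omega
  · intro p _ q _ hpq
    rw [Function.onFun, Finset.disjoint_left]
    rintro ⟨c, t⟩ h1 h2
    simp only [Finset.mem_product, Finset.mem_union, mem_treesFinset] at h1 h2
    apply hpq
    ext <;> grind

theorem treesFinset_zero (r : ℤ) : treesFinset r 0 = {node r []} := by
  ext ⟨l, cs⟩
  rw [mem_treesFinset, Finset.mem_singleton]
  constructor
  · rintro ⟨h1, -, h3⟩
    cases cs with
    | nil => simp only [rootLabel] at h1; rw [h1]
    | cons c cs => simp [edges, edgesBelow] at h3
  · intro h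
    rw [h]
    exact ⟨rfl, .node _ _ (by simp) (by simp), by simp [edges, edgesBelow]⟩

theorem card_treesFinset_succ (r : ℤ) (n : ℕ) :
    ((treesFinset r (n + 1)).card : ℝ) = ∑ p ∈ Finset.HasAntidiagonal.antidiagonal n,
      (((treesFinset (r + 1) p.1).card + (treesFinset (r - 1) p.1).card : ℝ) *
        (treesFinset r p.2).card) := by
  have := sum_treesFinset_succ r n (fun _ => 1)
  simp only [Finset.sum_const, nsmul_eq_mul, mul_one] at this
  rw [this]
  exact Finset.sum_congr rfl fun p _ => by ring

/-- Translation invariance of the labels, read off the recursion rather than from a bijection. -/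
theorem card_treesFinset_eq (n : ℕ) :
    ∀ r : ℤ, (treesFinset r n).card = (treesFinset 0 n).card := by
  induction n using Nat.strong_induction_on with
  | _ n ih =>
    intro r
    cases n with
    | zero => simp [treesFinset_zero]
    | succ n =>
      have h : ((treesFinset r (n + 1)).card : ℝ) = (treesFinset 0 (n + 1)).card := by
        rw [card_treesFinset_succ, card_treesFinset_succ]
        refine Finset.sum_congr rfl fun p hp => ?_
        have := Finset.HasAntidiagonal.mem_antidiagonal.1 hp
        rw [ih p.1 (by omega) (r + 1), ih p.1 (by omega) (r - 1), ih p.2 (by omega) r,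
          ih p.1 (by omega) (0 + 1), ih p.1 (by omega) (0 - 1)]
      exact_mod_cast h

/-- The total number of nodes labelled `j` in the trees with `n` edges and root label `r`. -/
noncomputable def totalNodes (j r : ℤ) (n : ℕ) : ℝ :=
  ∑ τ ∈ treesFinset r n, (τ.nodesLabelled j : ℝ)

theorem totalNodes_succ (j r : ℤ) (n : ℕ) :
    totalNodes j r (n + 1) = ∑ p ∈ Finset.HasAntidiagonal.antidiagonal n,
      ((totalNodes j (r + 1) p.1 + totalNodes j (r - 1) p.1) * (treesFinset 0 p.2).card +
        2 * (treesFinset 0 p.1).card * totalNodes j r p.2) := by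
  rw [totalNodes, sum_treesFinset_succ]
  refine Finset.sum_congr rfl fun p _ => ?_
  simp only [nodesLabelled_graft, Nat.cast_add, Finset.sum_add_distrib, Finset.sum_const,
    nsmul_eq_mul, ← Finset.mul_sum, card_treesFinset_eq p.1 (r + 1), card_treesFinset_eq p.2 r,
    card_treesFinset_eq p.1 (r - 1), totalNodes]
  ring

-- Generating functions

open PowerSeries

/-- The generating function of labelled trees with a given root label, counted by edges. -/
noncomputable def treeSeries : PowerSeries ℝ :=
  PowerSeries.mk fun n => ((treesFinset 0 n).card : ℝ)

/-- The generating function of labelled trees weighted by the number of their nodes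
labelled `j`. -/
noncomputable def nodeSeries (j r : ℤ) : PowerSeries ℝ := PowerSeries.mk fun n => totalNodes j r n

theorem treeSeries_eq : treeSeries = 1 + 2 * X * treeSeries ^ 2 := by
  ext n
  have h2 : (2 : PowerSeries ℝ) * X * treeSeries ^ 2 = X * (2 * (treeSeries * treeSeries)) := by
    ring
  have h3 : (2 : PowerSeries ℝ) = PowerSeries.C (2 : ℝ) := (map_ofNat _ 2).symm
  rw [h2, map_add]
  cases n with
  | zero => simp [treeSeries, treesFinset_zero]
  | succ n =>
    rw [coeff_succ_X_mul, h3, coeff_C_mul, coeff_mul, coeff_one]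
    simp only [treeSeries, coeff_mk, Nat.succ_ne_zero, if_false, zero_add]
    rw [card_treesFinset_succ, Finset.mul_sum]
    refine Finset.sum_congr rfl fun p _ => ?_
    rw [card_treesFinset_eq p.1 (0 + 1), card_treesFinset_eq p.1 (0 - 1)]
    ring

theorem nodeSeries_eq (j r : ℤ) :
    nodeSeries j r = PowerSeries.C (if r = j then 1 else 0) +
      X * (nodeSeries j (r + 1) + nodeSeries j (r - 1)) * treeSeries +
      2 * X * treeSeries * nodeSeries j r := by
  ext n
  have h2 : X * (nodeSeries j (r + 1) + nodeSeries j (r - 1)) * treeSeries =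
    X * ((nodeSeries j (r + 1) + nodeSeries j (r - 1)) * treeSeries) := by ring
  have h4 : 2 * X * treeSeries * nodeSeries j r = X * (2 * (treeSeries * nodeSeries j r)) := by ring
  have h3 : (2 : PowerSeries ℝ) = PowerSeries.C (2 : ℝ) := (map_ofNat _ 2).symm
  rw [h2, h4, map_add, map_add]
  cases n with
  | zero =>
    simp [nodeSeries, totalNodes, treesFinset_zero, nodesLabelled, nodesLabelledBelow]
  | succ n =>
    rw [coeff_succ_X_mul, coeff_succ_X_mul, h3, coeff_C_mul, coeff_mul, coeff_mul, coeff_C]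
    simp only [treeSeries, nodeSeries, coeff_mk, Nat.succ_ne_zero, if_false, zero_add, map_add]
    rw [totalNodes_succ, Finset.mul_sum, ← Finset.sum_add_distrib]
    refine Finset.sum_congr rfl fun p _ => ?_
    ring

/-- The quadratic equation says T(1 - 2XT) = 1, so multiplying by T solves `nodeSeries_eq` for its
diagonal term. -/
theorem nodeSeries_eq_treeSeries_mul (j r : ℤ) :
    nodeSeries j r = PowerSeries.C (if r = j then 1 else 0) * treeSeries +
      X * treeSeries ^ 2 * (nodeSeries j (r + 1) + nodeSeries j (r - 1)) := by
  linear_combination treeSeries * nodeSeries_eq j r - nodeSeries j r * treeSeries_eq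

-- Walk counts and explicit coefficients

/-- The number of walks with `k` steps `±1` from `0` to `x`. -/
noncomputable def walkCount : ℕ → ℤ → ℝ
  | 0, x => if x = 0 then 1 else 0
  | k + 1, x => walkCount k (x - 1) + walkCount k (x + 1)

theorem walkCount_neg (k : ℕ) : ∀ x : ℤ, walkCount k (-x) = walkCount k x := by
  induction k with
  | zero => simp [walkCount]
  | succ k ih =>
    intro x
    rw [walkCount, walkCount, show -x - 1 = -(x + 1) by ring, show -x + 1 = -(x - 1) by ring,
      ih, ih, add_comm]

theorem walkCount_eq_zero_of_lt (k : ℕ) : ∀ x : ℤ, x < -k → walkCount k x = 0 := by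
  induction k with
  | zero => intro x hx; simp at hx; simp [walkCount, hx.ne]
  | succ k ih =>
    intro x hx
    push_cast at hx
    rw [walkCount, ih _ (by omega), ih _ (by omega), add_zero]

theorem walkCount_eq_choose (k : ℕ) : ∀ a : ℕ, walkCount k (2 * a - k) = k.choose a := by
  induction k with
  | zero => intro a; cases a <;> simp [walkCount]; omega
  | succ k ih =>
    intro a
    rw [walkCount, show (2 * a - (k + 1 : ℕ) + 1 : ℤ) = 2 * a - k by push_cast; ring, ih]
    cases a with
    | zero => rw [walkCount_eq_zero_of_lt _ _ (by push_cast; omega)]; simp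
    | succ a =>
      rw [show (2 * (a + 1 : ℕ) - (k + 1 : ℕ) - 1 : ℤ) = 2 * a - k by push_cast; ring, ih,
        Nat.choose_succ_succ]
      push_cast
      ring

theorem walkCount_eq_zero_of_odd (k : ℕ) : ∀ x : ℤ, Odd (k + x) → walkCount k x = 0 := by
  induction k with
  | zero => intro x hx; rw [walkCount, if_neg]; rintro rfl; simp at hx
  | succ k ih =>
    intro x hx
    rw [walkCount, ih, ih, add_zero]
    · convert hx using 1; push_cast; ring
    · obtain ⟨y, hy⟩ := hx
      exact ⟨y - 1, by push_cast at hy; linarith⟩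

/-- Iterating `nodeSeries_eq_treeSeries_mul` moves the root label by one walk step and gains a
factor XT². Working modulo `X ^ K` keeps the expansion finite. -/
theorem X_pow_dvd_nodeSeries_sub (j : ℤ) (K : ℕ) : ∀ r : ℤ,
    (X : PowerSeries ℝ) ^ K ∣ nodeSeries j r - ∑ k ∈ Finset.range K,
      PowerSeries.C (walkCount k (j - r)) * (X ^ k * treeSeries ^ (2 * k + 1)) := by
  induction K with
  | zero => simp
  | succ K ih =>
    intro r
    obtain ⟨P, hP⟩ := ih (r + 1)
    obtain ⟨Q, hQ⟩ := ih (r - 1)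
    refine ⟨treeSeries ^ 2 * (P + Q), ?_⟩
    rw [nodeSeries_eq_treeSeries_mul, Finset.sum_range_succ']
    have h : ∑ k ∈ Finset.range K, PowerSeries.C (walkCount (k + 1) (j - r)) *
        ((X : PowerSeries ℝ) ^ (k + 1) * treeSeries ^ (2 * (k + 1) + 1)) =
        X * treeSeries ^ 2 * (∑ k ∈ Finset.range K,
          PowerSeries.C (walkCount k (j - (r + 1))) * (X ^ k * treeSeries ^ (2 * k + 1)) +
        ∑ k ∈ Finset.range K,
          PowerSeries.C (walkCount k (j - (r - 1))) * (X ^ k * treeSeries ^ (2 * k + 1))) := by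
      rw [← Finset.sum_add_distrib, Finset.mul_sum]
      refine Finset.sum_congr rfl fun k _ => ?_
      rw [walkCount, map_add, show j - r - 1 = j - (r + 1) by ring,
        show j - r + 1 = j - (r - 1) by ring]
      ring
    have h0 : (walkCount 0 (j - r)) = if r = j then 1 else 0 := by
      simp [walkCount, sub_eq_zero, eq_comm]
    rw [h, h0]
    linear_combination X * treeSeries ^ 2 * (hP + hQ)

theorem totalNodes_eq_sum (j r : ℤ) (n : ℕ) :
    totalNodes j r n = ∑ k ∈ Finset.range (n + 1),
      walkCount k (j - r) * coeff (n - k) (treeSeries ^ (2 * k + 1)) := by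
  have h := X_pow_dvd_iff.1 (X_pow_dvd_nodeSeries_sub j (n + 1) r) n (by omega)
  rw [map_sub, sub_eq_zero, map_sum] at h
  have h' : coeff n (nodeSeries j r) = totalNodes j r n := by simp [nodeSeries]
  rw [← h', h]
  refine Finset.sum_congr rfl fun k hk => ?_
  have := Finset.mem_range.1 hk
  rw [coeff_C_mul, coeff_X_pow_mul', if_pos (by omega)]

/-- The Lagrange inversion formula, here by double induction from T^(p+1) = T^p + 2X T^(p+2). The
factor 2m + p is kept on the left so that m = p = 0 needs no division. -/
theorem coeff_treeSeries_pow (m : ℕ) : ∀ p : ℕ,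
    (2 * m + p : ℝ) * coeff m (treeSeries ^ p) = 2 ^ m * p * (2 * m + p).choose m := by
  induction m with
  | zero =>
    intro p
    have : coeff 0 treeSeries = (1 : ℝ) := by simp [treeSeries, treesFinset_zero]
    have h : coeff 0 (treeSeries ^ p) = (1 : ℝ) := by
      rw [coeff_zero_eq_constantCoeff_apply] at this ⊢
      rw [map_pow, this, one_pow]
    simp [h]
  | succ m ih =>
    intro p
    induction p with
    | zero => simp [coeff_one]
    | succ p ihp =>
      have hrec : treeSeries ^ (p + 1) = treeSeries ^ p + X * (C 2 * treeSeries ^ (p + 2)) := by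
        have h3 : (2 : PowerSeries ℝ) = PowerSeries.C (2 : ℝ) := (map_ofNat _ 2).symm
        rw [← h3]
        linear_combination treeSeries ^ p * treeSeries_eq
      rw [hrec, map_add, coeff_succ_X_mul, coeff_C_mul]
      have h1 := ih (p + 2)
      have hM : 2 * (m + 1) + p = 2 * m + (p + 2) := by ring
      have e1 : (2 * (m + 1) + (p + 1)).choose (m + 1) =
          (2 * m + (p + 2)).choose m + (2 * m + (p + 2)).choose (m + 1) := by
        rw [show 2 * (m + 1) + (p + 1) = 2 * m + (p + 2) + 1 by ring, Nat.choose_succ_succ]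
      have e2 := Nat.choose_succ_right_eq (2 * m + (p + 2)) m
      rw [show 2 * m + (p + 2) - m = m + p + 2 by omega] at e2
      rw [hM] at ihp
      rw [e1]
      have e3 : ((2 * m + (p + 2)).choose (m + 1) : ℝ) * (m + 1) =
        (2 * m + (p + 2)).choose m * (m + p + 2) := by exact_mod_cast e2
      push_cast at ihp h1 ⊢
      generalize ((2 * m + (p + 2)).choose (m + 1) : ℝ) = x at *
      generalize ((2 * m + (p + 2)).choose m : ℝ) = y at *
      generalize coeff (m + 1) (treeSeries ^ p) = A at *
      generalize coeff m (treeSeries ^ (p + 2)) = B at *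
      have hne : (2 * (m : ℝ) + p + 2) ≠ 0 := by positivity
      apply mul_left_cancel₀ hne
      linear_combination (2 * (m : ℝ) + p + 3) * (ihp + 2 * h1) - 2 ^ (m + 2) * e3
end EmbeddedTrees

-- The exact mean as a sum over depths

namespace EmbeddedTrees
open LabelledTree

open PowerSeries in
theorem totalNodes_div_card (j : ℤ) (n : ℕ) :
    totalNodes j 0 n / (treesFinset 0 n).card = ∑ k ∈ Finset.range (n + 1),
      (2 * k + 1) * ((2 * n + 1).choose (n + 1 + k) / (2 * n + 1).choose (n + 1) : ℝ) *
        (walkCount k j / 2 ^ k) := by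
  have hW := coeff_treeSeries_pow n 1
  have h1 : coeff n (treeSeries ^ 1) = ((treesFinset 0 n).card : ℝ) := by simp [treeSeries]
  have hs1 : (2 * n + 1).choose (n + 1) = (2 * n + 1).choose n :=
    Nat.choose_symm_of_eq_add (by omega)
  rw [h1] at hW
  have hc : (0 : ℝ) < (2 * n + 1).choose n := by exact_mod_cast Nat.choose_pos (by omega)
  have hcard : ((treesFinset 0 n).card : ℝ) = 2 ^ n * (2 * n + 1).choose n / (2 * n + 1) := by
    field_simp
    push_cast at hW
    linear_combination hW
  rw [hcard, totalNodes_eq_sum, Finset.sum_div]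
  refine Finset.sum_congr rfl fun k hk => ?_
  have hk' : k ≤ n := by have := Finset.mem_range.1 hk; omega
  have hp := coeff_treeSeries_pow (n - k) (2 * k + 1)
  have hs2 : (2 * n + 1).choose (n + 1 + k) = (2 * n + 1).choose (n - k) :=
    Nat.choose_symm_of_eq_add (by omega)
  rw [show 2 * (n - k) + (2 * k + 1) = 2 * n + 1 by omega] at hp
  have hq : coeff (n - k) (treeSeries ^ (2 * k + 1)) =
      2 ^ (n - k) * (2 * k + 1) * (2 * n + 1).choose (n - k) / (2 * n + 1) := by
    have hcast : (2 * (n - k : ℕ) + (2 * k + 1 : ℕ) : ℝ) = 2 * n + 1 := by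
      push_cast [hk']; ring
    rw [hcast] at hp
    field_simp
    push_cast at hp
    linear_combination hp
  -- The quotient of the two powers of 2 is 2^(-k), which turns the walk count into a probability.
  have h2 : (2 : ℝ) ^ n = 2 ^ (n - k) * 2 ^ k := by rw [← pow_add]; congr 1; omega
  rw [hq, hs1, hs2, h2, sub_zero]
  field_simp

theorem integral_treeLaw (n : ℕ) (φ : LabelledTree → ℝ) :
    ∫ τ, φ τ ∂(treeLaw n) = (∑ τ ∈ treesFinset 0 n, φ τ) / (treesFinset 0 n).card := by
  have hset : treesFrom 0 n = (treesFinset 0 n : Set LabelledTree) := by simp [treesFinset]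
  have : MeasurableSingletonClass LabelledTree := ⟨fun _ => trivial⟩
  rw [treeLaw, uniformOn, ProbabilityTheory.cond, integral_smul_measure, hset,
    Measure.count_apply_finset, setIntegral_finset]
  · simp [Measure.real, div_eq_inv_mul]
  · refine ⟨(measurable_from_top (f := φ)).aestronglyMeasurable, ?_⟩
    rw [HasFiniteIntegral, lintegral_finset]
    simp [ENNReal.sum_lt_top]

theorem integral_normalizedCount (n : ℕ) (j : ℤ) :
    ∫ τ, normalizedCount n j τ ∂(treeLaw n) =
      totalNodes j 0 n / (treesFinset 0 n).card / (n : ℝ) ^ (3 / 4 : ℝ) := by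
  rw [integral_treeLaw]
  simp only [normalizedCount, ← Finset.sum_div, totalNodes]
  ring

-- Gaussian asymptotics of binomial ratios

/-- The ratio of a binomial coefficient of row `2 * N + s` at distance `d` from the centre to the
central one. -/
noncomputable def chooseRatio (N s d : ℕ) : ℝ :=
  ((2 * N + s).choose (N + s + d) : ℝ) / (2 * N + s).choose (N + s)

theorem chooseRatio_zero (N s : ℕ) : chooseRatio N s 0 = 1 :=
  div_self (by exact_mod_cast (Nat.choose_pos (by omega)).ne')

theorem chooseRatio_nonneg (N s d : ℕ) : 0 ≤ chooseRatio N s d := by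
  unfold chooseRatio; positivity

theorem chooseRatio_eq_zero {N s d : ℕ} (h : N < d) : chooseRatio N s d = 0 := by
  rw [chooseRatio, Nat.choose_eq_zero_of_lt (by omega)]; simp

theorem chooseRatio_succ {N s d : ℕ} (h : d ≤ N) :
    chooseRatio N s (d + 1) = chooseRatio N s d * ((N - d) / (N + s + d + 1)) := by
  have h1 := Nat.choose_succ_right_eq (2 * N + s) (N + s + d)
  rw [show 2 * N + s - (N + s + d) = N - d by omega] at h1
  have h2 : ((2 * N + s).choose (N + s + (d + 1)) : ℝ) * (N + s + d + 1) =
      (2 * N + s).choose (N + s + d) * (N - d) := by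
    rw [← Nat.cast_sub h]; exact_mod_cast h1
  have hc : (0 : ℝ) < (2 * N + s).choose (N + s) := by exact_mod_cast Nat.choose_pos (by omega)
  unfold chooseRatio
  field_simp
  linear_combination h2

/-- The ratio is a product of factors 1 - (2e+1+s)/(N+s+e+1). Each is at most the exponential of
minus its defect, and the numbers 2e+1+s for e < d add up to d² + sd. -/
theorem chooseRatio_le_exp {N s d : ℕ} (hN : 0 < N) :
    chooseRatio N s d ≤ Real.exp (-((d ^ 2 + s * d) / (N + s + d))) := by
  have hN' : (0 : ℝ) < N := by exact_mod_cast hN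
  -- The denominator is frozen at its worst value, so that the exponents add along the induction.
  suffices h : ∀ e ≤ d, chooseRatio N s e ≤ Real.exp (-((e ^ 2 + s * e) / (N + s + d))) from
    h d le_rfl
  intro e
  induction e with
  | zero => simp [chooseRatio_zero]
  | succ e ih =>
    intro he
    have he' : (e : ℝ) + 1 ≤ d := by exact_mod_cast he
    rcases lt_or_ge N (e + 1) with h | h
    · rw [chooseRatio_eq_zero h]; positivity
    · have hNe : (e : ℝ) + 1 ≤ N := by exact_mod_cast h
      rw [chooseRatio_succ (by omega)]
      have hle : ((N : ℝ) - e) / (N + s + e + 1) ≤ Real.exp (-((2 * e + 1 + s) / (N + s + d))) := by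
        have h1 : ((N : ℝ) - e) / (N + s + e + 1) = 1 - (2 * e + 1 + s) / (N + s + e + 1) := by
          field_simp; ring
        have h2 : (2 * (e : ℝ) + 1 + s) / (N + s + d) ≤ (2 * e + 1 + s) / (N + s + e + 1) := by
          gcongr _ / ?_; linarith
        have h3 := Real.one_sub_le_exp_neg ((2 * (e : ℝ) + 1 + s) / (N + s + d))
        linarith
      calc _ ≤ Real.exp (-((e ^ 2 + s * e) / (N + s + d))) *
            Real.exp (-((2 * e + 1 + s) / (N + s + d))) :=
            mul_le_mul (ih (by omega)) hle
              (div_nonneg (by linarith) (by positivity)) (Real.exp_pos _).le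
        _ = _ := by rw [← Real.exp_add]; congr 1; push_cast; ring

/-- Same product, through the inverse factors 1 + (2e+1+s)/(N-e), bounded by 1 + u ≤ exp u with the
smallest denominator N - d + 1. -/
theorem exp_le_chooseRatio {N s d : ℕ} (h : d ≤ N) :
    Real.exp (-((d ^ 2 + s * d) / (N - d + 1))) ≤ chooseRatio N s d := by
  have h' : (d : ℝ) ≤ N := by exact_mod_cast h
  suffices h : ∀ e ≤ d, Real.exp (-((e ^ 2 + s * e) / (N - d + 1))) ≤ chooseRatio N s e from
    h d le_rfl
  intro e
  induction e with
  | zero => simp [chooseRatio_zero]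
  | succ e ih =>
    intro he
    have he' : (e : ℝ) + 1 ≤ d := by exact_mod_cast he
    rw [chooseRatio_succ (by omega)]
    have hpos : (0 : ℝ) < N - d + 1 := by linarith
    have hpos' : (0 : ℝ) < N - e := by linarith
    have hle : Real.exp (-((2 * e + 1 + s) / (N - d + 1))) ≤ ((N : ℝ) - e) / (N + s + e + 1) := by
      have h1 : ((N : ℝ) - e) / (N + s + e + 1) = ((2 * (e : ℝ) + 1 + s) / (N - e) + 1)⁻¹ := by
        field_simp; ring
      have h2 : (2 * (e : ℝ) + 1 + s) / (N - e) ≤ (2 * e + 1 + s) / (N - d + 1) := by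
        gcongr _ / ?_; linarith
      rw [h1, Real.exp_neg]
      refine inv_anti₀ (by positivity) ?_
      have h3 := Real.add_one_le_exp ((2 * (e : ℝ) + 1 + s) / (N - d + 1))
      linarith
    calc _ = Real.exp (-((e ^ 2 + s * e) / (N - d + 1))) *
            Real.exp (-((2 * e + 1 + s) / (N - d + 1))) := by
            rw [← Real.exp_add]; congr 1; push_cast; ring
      _ ≤ _ := mul_le_mul (ih (by omega)) hle (Real.exp_pos _).le (chooseRatio_nonneg _ _ _)

theorem tendsto_chooseRatio {N s d : ℕ → ℕ} {c : ℝ} (hN : Tendsto N atTop atTop)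
    (hs : ∀ n, s n ≤ 1) (hd : Tendsto (fun n => (d n : ℝ) ^ 2 / N n) atTop (𝓝 c)) :
    Tendsto (fun n => chooseRatio (N n) (s n) (d n)) atTop (𝓝 (Real.exp (-c))) := by
  have hN' : Tendsto (fun n => (N n : ℝ)) atTop atTop :=
    tendsto_natCast_atTop_atTop.comp hN
  have hinv : Tendsto (fun n => ((N n : ℝ))⁻¹) atTop (𝓝 0) := tendsto_inv_atTop_zero.comp hN'
  have hdN : Tendsto (fun n => (d n : ℝ) / N n) atTop (𝓝 0) := by
    -- (d/N)² = (d²/N)(1/N) tends to 0.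
    have h := (hd.mul hinv).sqrt
    simp only [mul_zero, Real.sqrt_zero] at h
    refine h.congr fun n => ?_
    rw [← Real.sqrt_sq (show (0 : ℝ) ≤ d n / N n by positivity)]
    congr 1
    ring
  have hs' : ∀ n, (s n : ℝ) ≤ 1 := fun n => by exact_mod_cast hs n
  have hsN : Tendsto (fun n => (s n : ℝ) / N n) atTop (𝓝 0) := by
    refine squeeze_zero (fun n => by positivity) (fun n => ?_) hinv
    rw [← one_div]
    have := hs' n
    gcongr
  have hsd : Tendsto (fun n => (s n : ℝ) * (d n / N n)) atTop (𝓝 0) := by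
    refine squeeze_zero (fun n => by positivity) (fun n => ?_) hdN
    exact mul_le_of_le_one_left (by positivity) (hs' n)
  have hpos : ∀ᶠ n in atTop, 0 < N n := hN.eventually_gt_atTop 0
  have hdle : ∀ᶠ n in atTop, d n ≤ N n := by
    filter_upwards [hpos, hdN.eventually (gt_mem_nhds one_pos)] with n h1 h2
    have h1' : (0 : ℝ) < N n := by exact_mod_cast h1
    rw [div_lt_one h1'] at h2
    exact_mod_cast h2.le
  have hup : Tendsto (fun n => ((d n : ℝ) ^ 2 + s n * d n) / (N n + s n + d n)) atTop (𝓝 c) := by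
    have h := (hd.add hsd).div ((tendsto_const_nhds (x := (1 : ℝ))).add hsN |>.add hdN)
      (by norm_num)
    simp only [add_zero, div_one] at h
    refine h.congr' ?_
    filter_upwards [hpos] with n h1
    have h1' : (0 : ℝ) < N n := by exact_mod_cast h1
    simp only [Pi.div_apply]
    field_simp
  have hlow : Tendsto (fun n => ((d n : ℝ) ^ 2 + s n * d n) / (N n - d n + 1)) atTop (𝓝 c) := by
    have h := (hd.add hsd).div ((tendsto_const_nhds (x := (1 : ℝ))).sub hdN |>.add hinv)
      (by norm_num)
    simp only [add_zero, div_one, sub_zero] at h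
    refine h.congr' ?_
    filter_upwards [hpos, hdle] with n h1 h2
    have h1' : (0 : ℝ) < N n := by exact_mod_cast h1
    have h2' : (d n : ℝ) ≤ N n := by exact_mod_cast h2
    have h3 : (0 : ℝ) < N n - d n + 1 := by linarith
    simp only [Pi.div_apply]
    have h4 : 1 - (d n : ℝ) / N n + (N n : ℝ)⁻¹ = (N n - d n + 1) / N n := by field_simp
    rw [h4]
    field_simp
  refine tendsto_of_tendsto_of_tendsto_of_le_of_le'
    ((Real.continuous_exp.tendsto _).comp hlow.neg) ((Real.continuous_exp.tendsto _).comp hup.neg)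
    ?_ ?_
  · filter_upwards [hdle] with n h
    exact exp_le_chooseRatio h
  · filter_upwards [hpos] with n h
    exact chooseRatio_le_exp h

-- Return probabilities and walk probabilities

/-- The probability that simple random walk is back at its starting point after `2 * i` steps. -/
noncomputable def returnProb (i : ℕ) : ℝ := (i.centralBinom : ℝ) / 4 ^ i

theorem returnProb_nonneg (i : ℕ) : 0 ≤ returnProb i := by unfold returnProb; positivity

theorem returnProb_succ (i : ℕ) :
    returnProb (i + 1) = returnProb i * ((2 * i + 1) / (2 * i + 2)) := by
  have h : ((i : ℝ) + 1) * (i + 1).centralBinom = 2 * (2 * i + 1) * i.centralBinom := by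
    exact_mod_cast Nat.succ_mul_centralBinom_succ i
  unfold returnProb
  rw [pow_succ]
  field_simp
  linear_combination 2 * h

/-- The left side equals 1 at i = 0 and does not increase, because (2i+1)(2i+3) ≤ (2i+2)². -/
theorem returnProb_sq_mul_le (i : ℕ) : returnProb i ^ 2 * (2 * i + 1) ≤ 1 := by
  induction i with
  | zero => simp [returnProb]
  | succ i ih =>
    refine le_trans ?_ ih
    rw [returnProb_succ, mul_pow, mul_assoc]
    gcongr
    rw [div_pow, div_mul_eq_mul_div, div_le_iff₀ (by positivity)]
    push_cast
    nlinarith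

/-- In the quotient of the Stirling sequence at 2i by its square at i, the exponential factors
cancel and exactly √i times the return probability remains. -/
theorem tendsto_sqrt_mul_returnProb :
    Tendsto (fun i : ℕ => √(i : ℝ) * returnProb i) atTop (𝓝 (1 / √Real.pi)) := by
  have h1 := Stirling.tendsto_stirlingSeq_sqrt_pi
  have h2 : Tendsto (fun i : ℕ => 2 * i) atTop atTop := tendsto_id.const_mul_atTop' two_pos
  have hpi : √Real.pi ≠ 0 := (Real.sqrt_pos.2 Real.pi_pos).ne'
  have h := (h1.comp h2).div (h1.pow 2) (pow_ne_zero 2 hpi)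
  have hlim : √Real.pi / √Real.pi ^ 2 = 1 / √Real.pi := by field_simp
  rw [hlim] at h
  refine h.congr' ?_
  filter_upwards [eventually_gt_atTop 0] with i hi
  have hi' : (0 : ℝ) < i := by exact_mod_cast hi
  have hc : (i.centralBinom : ℝ) = (2 * i).factorial / (i.factorial * i.factorial) := by
    rw [Nat.centralBinom_eq_two_mul_choose, two_mul, Nat.cast_add_choose]
  simp only [Pi.div_apply, Function.comp, Stirling.stirlingSeq, returnProb, hc]
  have e1 : √(2 * ((2 * i : ℕ) : ℝ)) = 2 * √i := by
    rw [show (2 * ((2 * i : ℕ) : ℝ)) = 2 ^ 2 * i by push_cast; ring, Real.sqrt_mul (by positivity),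
      Real.sqrt_sq (by positivity)]
  have e2 : √(2 * (i : ℝ)) ^ 2 = 2 * i := Real.sq_sqrt (by positivity)
  have e3 : √(i : ℝ) * √(i : ℝ) = i := Real.mul_self_sqrt hi'.le
  have e4 : (((2 * i : ℕ) : ℝ) / Real.exp 1) ^ (2 * i) = 4 ^ i * ((i / Real.exp 1) ^ i) ^ 2 := by
    rw [← pow_mul, mul_comm i 2, Nat.cast_mul, mul_div_assoc, mul_pow, pow_mul]
    norm_num
  have hs : 0 < √(i : ℝ) := Real.sqrt_pos.2 hi'
  have hE : (0 : ℝ) < (i / Real.exp 1) ^ i := by positivity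
  rw [e1, e4]
  generalize ((i : ℝ) / Real.exp 1) ^ i = E at hE
  rw [div_pow, mul_pow, e2]
  field_simp
  linear_combination -e3

theorem choose_div_two_pow {s : ℕ} (hs : s ≤ 1) (i : ℕ) :
    ((2 * i + s).choose (i + s) : ℝ) / 2 ^ (2 * i + s) = returnProb (i + s) := by
  have h4 : (2 : ℝ) ^ (2 * i) = 4 ^ i := by rw [pow_mul]; norm_num
  interval_cases s
  · simp [returnProb, Nat.centralBinom_eq_two_mul_choose, h4]
  · have h : (i + 1).centralBinom = 2 * (2 * i + 1).choose (i + 1) := by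
      have h1 : (2 * i + 1).choose (i + 1) = (2 * i + 1).choose i :=
        Nat.choose_symm_of_eq_add (by omega)
      rw [Nat.centralBinom_eq_two_mul_choose, show 2 * (i + 1) = 2 * i + 1 + 1 by ring,
        Nat.choose_succ_succ, Nat.succ_eq_add_one, ← h1]
      ring
    rw [returnProb, h, pow_succ, h4, pow_succ]
    push_cast
    field_simp
    norm_num

/-- The parity `s` is shared by the number of steps and the end point; this reduces a walk
probability to a central term and a binomial ratio. -/
theorem walkCount_div_two_pow {s : ℕ} (hs : s ≤ 1) (i d : ℕ) {j : ℤ} (hj : j.natAbs = 2 * d + s) :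
    walkCount (2 * i + s) j / 2 ^ (2 * i + s) = returnProb (i + s) * chooseRatio i s d := by
  have h1 : walkCount (2 * i + s) j = walkCount (2 * i + s) (2 * d + s) := by
    rcases Int.natAbs_eq j with h | h <;> rw [h, hj]
    · push_cast; rfl
    · rw [walkCount_neg]; push_cast; rfl
  have h2 : (2 * d + s : ℤ) = 2 * ((i + s + d : ℕ) : ℤ) - (2 * i + s : ℕ) := by push_cast; ring
  have hc : ((2 * i + s).choose (i + s) : ℝ) ≠ 0 := by
    exact_mod_cast (Nat.choose_pos (by omega)).ne'
  rw [h1, h2, walkCount_eq_choose, ← choose_div_two_pow hs, chooseRatio]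
  field_simp

theorem sum_range_eq_sum_two_mul_add (g : ℕ → ℝ) {n s : ℕ} (hs : s ≤ 1)
    (h1 : ∀ k, n < k → g k = 0) (h2 : ∀ k, (k + s) % 2 = 1 → g k = 0) :
    -- The upper limit on the right is generous: terms with 2i + s > n vanish by `h1`.
    ∑ k ∈ Finset.range (n + 1), g k = ∑ i ∈ Finset.range (n + 1), g (2 * i + s) := by
  have h3 : ∑ k ∈ Finset.range (n + 1), g k = ∑ k ∈ Finset.range (2 * (n + 1)), g k := by
    refine Finset.sum_subset (Finset.range_subset_range.2 (by omega)) fun k _ hk => h1 k ?_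
    simp at hk
    omega
  have h4 : ∀ m, ∑ k ∈ Finset.range (2 * m), g k = ∑ i ∈ Finset.range m, g (2 * i + s) := by
    intro m
    induction m with
    | zero => simp
    | succ m ih =>
      rw [show 2 * (m + 1) = 2 * m + 1 + 1 by ring, Finset.sum_range_succ, Finset.sum_range_succ,
        Finset.sum_range_succ, ih]
      interval_cases s
      · rw [h2 (2 * m + 1) (by omega)]; simp
      · rw [h2 (2 * m) (by omega)]; simp
  rw [h3, h4]

/-- The mean number of nodes at depth `2 * i + s` carrying a given label `± (2 * d + s)` in a
random tree with `n` edges. -/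
noncomputable def meanAtDepth (n s d i : ℕ) : ℝ :=
  (2 * (2 * i + s : ℕ) + 1) * chooseRatio n 1 (2 * i + s) *
    (returnProb (i + s) * chooseRatio i s d)

theorem totalNodes_div_card_eq_sum_meanAtDepth (n : ℕ) (j : ℤ) :
    totalNodes j 0 n / (treesFinset 0 n).card = ∑ i ∈ Finset.range (n + 1),
      meanAtDepth n (j.natAbs % 2) (j.natAbs / 2) i := by
  have hs : j.natAbs % 2 ≤ 1 := by omega
  rw [totalNodes_div_card, sum_range_eq_sum_two_mul_add _ hs]
  · refine Finset.sum_congr rfl fun i _ => ?_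
    rw [walkCount_div_two_pow hs i (j.natAbs / 2) (by omega)]
    rfl
  · intro k hk
    rw [Nat.choose_eq_zero_of_lt (by omega)]
    simp
  · intro k hk
    rw [walkCount_eq_zero_of_odd]
    · simp
    · rw [Int.odd_iff]; omega

theorem meanAtDepth_nonneg (n s d i : ℕ) : 0 ≤ meanAtDepth n s d i := by
  have := chooseRatio_nonneg n 1 (2 * i + s)
  have := chooseRatio_nonneg i s d
  have := returnProb_nonneg (i + s)
  unfold meanAtDepth
  positivity

theorem meanAtDepth_eq_zero {n s d i : ℕ} (h : n < i) : meanAtDepth n s d i = 0 := by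
  rw [meanAtDepth, chooseRatio_eq_zero (by omega)]
  simp
end EmbeddedTrees

-- Rescaling and dominated convergence

namespace EmbeddedTrees
open LabelledTree

theorem integral_Ioi_floor_eq_sum (g : ℕ → ℝ) {N : ℕ} (hg : ∀ i, N ≤ i → g i = 0) :
    ∫ u in Set.Ioi (0 : ℝ), g ⌊u⌋₊ = ∑ i ∈ Finset.range N, g i := by
  have hcongr : ∀ k : ℕ, ∀ᵐ u : ℝ, u ∈ Set.uIoc (k : ℝ) ((k + 1 : ℕ) : ℝ) → g ⌊u⌋₊ = g k := by
    intro k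
    -- On (k, k+1] the floor differs from k only at the right end point, a null set.
    have h0 : ∀ᵐ u : ℝ, u ≠ ((k + 1 : ℕ) : ℝ) := by
      simp [ae_iff]
    filter_upwards [h0] with u hu hmem
    rw [Set.uIoc_of_le (by push_cast; linarith)] at hmem
    congr 1
    rw [Nat.floor_eq_iff ((Nat.cast_nonneg k).trans hmem.1.le)]
    refine ⟨hmem.1.le, ?_⟩
    have := lt_of_le_of_ne hmem.2 hu
    push_cast at this
    exact this
  have hint : ∀ k : ℕ, IntervalIntegrable (fun u : ℝ => g ⌊u⌋₊) volume k ((k + 1 : ℕ) : ℝ) := by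
    intro k
    refine (intervalIntegrable_const (c := g k)).congr_ae ?_
    rw [Filter.EventuallyEq, ae_restrict_iff' measurableSet_uIoc]
    filter_upwards [hcongr k] with u hu hmem
    exact (hu hmem).symm
  have hval : ∀ k : ℕ, ∫ u in (k : ℝ)..((k + 1 : ℕ) : ℝ), g ⌊u⌋₊ = g k := by
    intro k
    rw [intervalIntegral.integral_congr_ae (hcongr k)]
    simp
  have hsum := intervalIntegral.sum_integral_adjacent_intervals (a := fun k : ℕ => (k : ℝ))
    (n := N) (fun k _ => hint k)
  simp only [hval, Nat.cast_zero] at hsum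
  rw [hsum, intervalIntegral.integral_of_le (by positivity)]
  refine setIntegral_eq_of_subset_of_forall_sdiff_eq_zero measurableSet_Ioi
    Set.Ioc_subset_Ioi_self fun u hu => hg _ (Nat.le_floor ?_)
  simp only [Set.mem_sdiff, Set.mem_Ioi, Set.mem_Ioc, not_and, not_le] at hu
  exact (hu.2 hu.1).le

theorem quarter_rpow_pow_four (n : ℕ) : ((n : ℝ) ^ (1 / 4 : ℝ)) ^ 4 = n := by
  rw [← Real.rpow_natCast, ← Real.rpow_mul (by positivity)]; norm_num

theorem tendsto_quarter_rpow : Tendsto (fun n : ℕ => (n : ℝ) ^ (1 / 4 : ℝ)) atTop atTop :=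
  (tendsto_rpow_atTop (by norm_num)).comp tendsto_natCast_atTop_atTop

/-- The rescaled step function whose integral is the mean of the normalized count. -/
noncomputable def scaledMean (n s d : ℕ) (x : ℝ) : ℝ :=
  meanAtDepth n s d ⌊((n : ℝ) ^ (1 / 4 : ℝ)) ^ 2 / 2 * x⌋₊ / (2 * (n : ℝ) ^ (1 / 4 : ℝ))

/-- The substitution u = q²x/2 has Jacobian q²/2, and division by n^(3/4) = q³ leaves the factor
1/(2q). -/
theorem integral_normalizedCount_eq_integral_scaledMean {n : ℕ} (hn : 0 < n) (j : ℤ) :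
    ∫ τ, normalizedCount n j τ ∂(treeLaw n) =
      ∫ x in Set.Ioi (0 : ℝ), scaledMean n (j.natAbs % 2) (j.natAbs / 2) x := by
  have hq : 0 < (n : ℝ) ^ (1 / 4 : ℝ) := by positivity
  have h3 : (n : ℝ) ^ (3 / 4 : ℝ) = ((n : ℝ) ^ (1 / 4 : ℝ)) ^ 3 := by
    rw [← Real.rpow_natCast, ← Real.rpow_mul (by positivity)]; norm_num
  rw [integral_normalizedCount, totalNodes_div_card_eq_sum_meanAtDepth, h3]
  simp only [scaledMean]
  generalize (n : ℝ) ^ (1 / 4 : ℝ) = q at *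
  rw [integral_div, integral_comp_mul_left_Ioi (fun u => meanAtDepth n _ _ ⌊u⌋₊) 0
    (show 0 < q ^ 2 / 2 by positivity), mul_zero,
    integral_Ioi_floor_eq_sum (meanAtDepth n _ _) (N := n + 1) (fun i hi => meanAtDepth_eq_zero (by omega))]
  simp only [smul_eq_mul]
  field_simp

theorem chooseRatio_le_one (N s d : ℕ) : chooseRatio N s d ≤ 1 := by
  rcases Nat.eq_zero_or_pos N with rfl | hN
  · rcases Nat.eq_zero_or_pos d with rfl | hd
    · rw [chooseRatio_zero]
    · rw [chooseRatio_eq_zero hd]; exact zero_le_one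
  · refine (chooseRatio_le_exp hN).trans (Real.exp_le_one_iff.2 ?_)
    rw [neg_nonpos]
    positivity

/-- The ratio vanishes for k > n; otherwise n + 1 + k ≤ 3n. -/
theorem chooseRatio_le_exp_neg_sq {n : ℕ} (hn : 0 < n) (k : ℕ) :
    chooseRatio n 1 k ≤ Real.exp (-(k ^ 2 / (3 * n))) := by
  rcases lt_or_ge n k with h | h
  · rw [chooseRatio_eq_zero h]; positivity
  · refine (chooseRatio_le_exp hn).trans (Real.exp_le_exp.2 (neg_le_neg ?_))
    have hn' : (1 : ℝ) ≤ n := by exact_mod_cast hn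
    have hk : (k : ℝ) ≤ n := by exact_mod_cast h
    rw [Nat.cast_one]
    gcongr
    · nlinarith [(Nat.cast_nonneg k : (0 : ℝ) ≤ k)]
    · linarith

theorem scaledMean_nonneg (n s d : ℕ) (x : ℝ) : 0 ≤ scaledMean n s d x :=
  div_nonneg (meanAtDepth_nonneg _ _ _ _) (by positivity)

theorem meanAtDepth_le {n s : ℕ} (hn : 0 < n) (d i : ℕ) :
    meanAtDepth n s d i ≤
      2 * √(2 * i + s + 1) * Real.exp (-((2 * i + s : ℝ) ^ 2 / (3 * n))) := by
  have hpos : (0 : ℝ) < 2 * i + s + 1 := by positivity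
  have h1 : returnProb (i + s) * √(2 * i + s + 1) ≤ 1 := by
    rw [← abs_of_nonneg (returnProb_nonneg (i + s)), ← Real.sqrt_sq_eq_abs,
      ← Real.sqrt_mul (sq_nonneg _)]
    rw [Real.sqrt_le_one]
    refine le_trans ?_ (returnProb_sq_mul_le (i + s))
    gcongr
    push_cast
    linarith [(Nat.cast_nonneg s : (0 : ℝ) ≤ s)]
  have h2 := chooseRatio_le_exp_neg_sq hn (2 * i + s)
  push_cast at h2
  have hs : √(2 * (i : ℝ) + s + 1) * √(2 * i + s + 1) = 2 * i + s + 1 :=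
    Real.mul_self_sqrt hpos.le
  have h3 : (2 * (2 * (i : ℝ) + s) + 1) * returnProb (i + s) ≤ 2 * √(2 * i + s + 1) := by
    calc (2 * (2 * (i : ℝ) + s) + 1) * returnProb (i + s)
        ≤ 2 * (2 * i + s + 1) * returnProb (i + s) := by
          gcongr
          · exact returnProb_nonneg _
          · linarith
      _ = 2 * √(2 * i + s + 1) * (returnProb (i + s) * √(2 * i + s + 1)) := by
          linear_combination -2 * returnProb (i + s) * hs
      _ ≤ 2 * √(2 * i + s + 1) * 1 := by gcongr
      _ = _ := mul_one _
  calc meanAtDepth n s d i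
      = (2 * (2 * (i : ℝ) + s) + 1) * returnProb (i + s) * chooseRatio n 1 (2 * i + s) *
          chooseRatio i s d := by rw [meanAtDepth]; push_cast; ring
    _ ≤ 2 * √(2 * i + s + 1) * Real.exp (-((2 * i + s : ℝ) ^ 2 / (3 * n))) * 1 := by
        refine mul_le_mul (mul_le_mul h3 h2 (chooseRatio_nonneg _ _ _) (by positivity))
          (chooseRatio_le_one _ _ _) (chooseRatio_nonneg _ _ _) (by positivity)
    _ = _ := mul_one _

/-- The dominating function, uniform in n, d and s. The factor `Real.exp 2` absorbs the rounding in
the floor: q²x ≤ (2i+s) + 2 and (A+2)² ≤ 2A² + 8, which also explains 1/6 in place of 1/3. -/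
theorem scaledMean_le {n s : ℕ} (hn : 0 < n) (hs : s ≤ 1) (d : ℕ) {x : ℝ} (hx : 0 < x) :
    scaledMean n s d x ≤ (x + 2) * (Real.exp 2 * Real.exp (-(1 / 6) * x ^ 2)) := by
  have hq1 : 1 ≤ (n : ℝ) ^ (1 / 4 : ℝ) :=
    Real.one_le_rpow (by exact_mod_cast hn) (by norm_num)
  have hq4 := quarter_rpow_pow_four n
  rw [scaledMean]
  generalize (n : ℝ) ^ (1 / 4 : ℝ) = q at *
  have hq : 0 < q := by linarith
  set i := ⌊q ^ 2 / 2 * x⌋₊ with hi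
  have hi1 : (i : ℝ) ≤ q ^ 2 / 2 * x := Nat.floor_le (by positivity)
  have hi2 : q ^ 2 / 2 * x < i + 1 := Nat.lt_floor_add_one _
  have hs' : (s : ℝ) ≤ 1 := by exact_mod_cast hs
  have hs0 : (0 : ℝ) ≤ s := by positivity
  have hi0 : (0 : ℝ) ≤ i := by positivity
  have h1 : √(2 * i + s + 1) ≤ q * (x + 2) := by
    rw [Real.sqrt_le_left (by positivity)]
    nlinarith [sq_nonneg q, mul_pos hx hx, mul_pos (mul_pos hq hq) hx,
      mul_pos (mul_pos hq hq) (mul_pos hx hx)]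
  have h2 : Real.exp (-((2 * i + s : ℝ) ^ 2 / (3 * n))) ≤
      Real.exp 2 * Real.exp (-(1 / 6) * x ^ 2) := by
    rw [← Real.exp_add, Real.exp_le_exp, ← hq4]
    have h3 : q ^ 2 * x ≤ (2 * i + s) + 2 := by linarith
    have h4 : (q ^ 2 * x) ^ 2 ≤ 2 * (2 * i + s) ^ 2 + 8 := by
      have : (q ^ 2 * x) ^ 2 ≤ ((2 * i + s) + 2) ^ 2 := by gcongr
      nlinarith [sq_nonneg ((2 * (i : ℝ) + s) - 2)]
    have h5 : (1 / 6) * x ^ 2 - 2 ≤ (2 * i + s : ℝ) ^ 2 / (3 * q ^ 4) := by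
      rw [le_div_iff₀ (by positivity)]
      nlinarith [one_le_pow₀ hq1 (n := 4)]
    linarith
  rw [div_le_iff₀ (by positivity)]
  calc meanAtDepth n s d i ≤ _ := meanAtDepth_le hn d i
    _ ≤ 2 * (q * (x + 2)) * (Real.exp 2 * Real.exp (-(1 / 6) * x ^ 2)) := by gcongr
    _ = _ := by ring

theorem integrable_scaledMean_bound :
    IntegrableOn (fun x : ℝ => (x + 2) * (Real.exp 2 * Real.exp (-(1 / 6) * x ^ 2)))
      (Set.Ioi 0) := by
  have h1 := integrable_mul_exp_neg_mul_sq (b := 1 / 6) (by norm_num)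
  have h2 := integrable_exp_neg_mul_sq (b := 1 / 6) (by norm_num)
  refine (((h1.const_mul (Real.exp 2)).add (h2.const_mul (2 * Real.exp 2))).congr ?_).integrableOn
  exact ae_of_all _ fun x => by simp only [Pi.add_apply]; ring

theorem measurable_scaledMean (n s d : ℕ) : Measurable (scaledMean n s d) := by
  unfold scaledMean
  exact ((measurable_from_nat (f := meanAtDepth n s d)).comp
    (Nat.measurable_floor.comp (measurable_const_mul _))).div_const _

theorem tendsto_natAbs_floor_div (lam : ℝ) :
    Tendsto (fun n : ℕ => ((⌊lam * (n : ℝ) ^ (1 / 4 : ℝ)⌋.natAbs : ℕ) : ℝ) /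
      (n : ℝ) ^ (1 / 4 : ℝ)) atTop (𝓝 |lam|) := by
  have hinv := tendsto_inv_atTop_zero.comp tendsto_quarter_rpow
  have h : Tendsto (fun n : ℕ => (⌊lam * (n : ℝ) ^ (1 / 4 : ℝ)⌋ : ℝ) / (n : ℝ) ^ (1 / 4 : ℝ))
      atTop (𝓝 lam) := by
    have hl : Tendsto (fun n : ℕ => lam - ((n : ℝ) ^ (1 / 4 : ℝ))⁻¹) atTop (𝓝 lam) := by
      simpa using tendsto_const_nhds.sub hinv
    refine tendsto_of_tendsto_of_tendsto_of_le_of_le' hl tendsto_const_nhds ?_ ?_ <;>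
      filter_upwards [tendsto_quarter_rpow.eventually_gt_atTop 0] with n hn <;>
      generalize (n : ℝ) ^ (1 / 4 : ℝ) = q at *
    · rw [le_div_iff₀ hn, sub_mul, inv_mul_cancel₀ hn.ne']
      exact (Int.sub_one_lt_floor _).le
    · rw [div_le_iff₀ hn]
      exact Int.floor_le _
  refine h.abs.congr fun n => ?_
  rw [abs_div, abs_of_nonneg (show 0 ≤ (n : ℝ) ^ (1 / 4 : ℝ) by positivity), Nat.cast_natAbs,
    Int.cast_abs]

theorem tendsto_scaledMean (lam : ℝ) {x : ℝ} (hx : 0 < x) :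
    Tendsto (fun n : ℕ => scaledMean n (⌊lam * (n : ℝ) ^ (1 / 4 : ℝ)⌋.natAbs % 2)
      (⌊lam * (n : ℝ) ^ (1 / 4 : ℝ)⌋.natAbs / 2) x) atTop
      (𝓝 (√2 / √Real.pi * (x ^ (1 / 2 : ℝ) * Real.exp (-x ^ 2 - |lam| ^ 2 / (2 * x))))) := by
  have hj := tendsto_natAbs_floor_div lam
  have hq := tendsto_quarter_rpow
  have hq4 := quarter_rpow_pow_four
  unfold scaledMean
  revert hj
  -- Only the limits of |j|/q and q and the identity q⁴ = n matter from here on, so both sequences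
  -- are made opaque.
  generalize hJ : (fun n : ℕ => ⌊lam * (n : ℝ) ^ (1 / 4 : ℝ)⌋.natAbs) = J
  have hJ' : ∀ n : ℕ, ⌊lam * (n : ℝ) ^ (1 / 4 : ℝ)⌋.natAbs = J n := fun n => by rw [← hJ]
  simp only [hJ']
  clear hJ hJ'
  revert hq hq4
  generalize hQ : (fun n : ℕ => (n : ℝ) ^ (1 / 4 : ℝ)) = q
  have hQ' : ∀ n : ℕ, (n : ℝ) ^ (1 / 4 : ℝ) = q n := fun n => by rw [← hQ]
  simp only [hQ']
  clear hQ hQ'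
  intro hq hq4 hj
  have hqpos : ∀ᶠ n in atTop, 0 < q n := hq.eventually_gt_atTop 0
  have hq2 : Tendsto (fun n => q n ^ 2 / 2 * x) atTop atTop :=
    ((tendsto_pow_atTop two_ne_zero).comp hq |>.atTop_div_const two_pos).atTop_mul_const hx
  have hinv : Tendsto (fun n => (q n)⁻¹) atTop (𝓝 0) := tendsto_inv_atTop_zero.comp hq
  have hinv2 : Tendsto (fun n => (q n ^ 2)⁻¹) atTop (𝓝 0) :=
    tendsto_inv_atTop_zero.comp ((tendsto_pow_atTop two_ne_zero).comp hq)
  set i : ℕ → ℕ := fun n => ⌊q n ^ 2 / 2 * x⌋₊ with hi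
  set s : ℕ → ℕ := fun n => J n % 2 with hs
  set d : ℕ → ℕ := fun n => J n / 2 with hd
  have hs1 : ∀ n, s n ≤ 1 := fun n => by simp only [hs]; omega
  have hs1' : ∀ n, (s n : ℝ) ≤ 1 := fun n => by exact_mod_cast hs1 n
  have hiTop : Tendsto i atTop atTop := tendsto_nat_floor_atTop.comp hq2
  have hiq : Tendsto (fun n => (i n : ℝ) / q n ^ 2) atTop (𝓝 (x / 2)) := by
    have h := (tendsto_nat_floor_mul_div_atTop (R := ℝ) (a := x / 2) (by positivity)).comp
      ((tendsto_pow_atTop two_ne_zero).comp hq)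
    refine h.congr fun n => ?_
    simp only [Function.comp, hi]
    rw [show x / 2 * q n ^ 2 = q n ^ 2 / 2 * x by ring]
  have hsq2 : Tendsto (fun n => (s n : ℝ) / q n ^ 2) atTop (𝓝 0) := by
    refine squeeze_zero (fun n => by positivity) (fun n => ?_) hinv2
    rw [← one_div]
    have := hs1' n
    gcongr
  have hkq : Tendsto (fun n => ((2 * i n + s n : ℕ) : ℝ) / q n ^ 2) atTop (𝓝 x) := by
    have h := (hiq.const_mul 2).add hsq2
    rw [show 2 * (x / 2) + 0 = x by ring] at h
    refine h.congr fun n => ?_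
    push_cast
    ring
  have hR : Tendsto (fun n => chooseRatio n 1 (2 * i n + s n)) atTop (𝓝 (Real.exp (-x ^ 2))) := by
    refine tendsto_chooseRatio (N := fun n => n) (s := fun _ => 1) tendsto_id (fun _ => le_rfl)
      ((hkq.pow 2).congr fun n => ?_)
    rw [← hq4 n, div_pow]
    ring
  have hdq : Tendsto (fun n => (d n : ℝ) / q n) atTop (𝓝 (|lam| / 2)) := by
    have hsq : Tendsto (fun n => (s n : ℝ) / q n) atTop (𝓝 0) := by
      refine squeeze_zero' (hqpos.mono fun n hn => by positivity) (hqpos.mono fun n hn => ?_) hinv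
      rw [← one_div]
      have := hs1' n
      gcongr
    have h := (hj.sub hsq).div_const 2
    rw [sub_zero] at h
    refine h.congr fun n => ?_
    have hJ : (J n : ℝ) = 2 * d n + s n := by
      simp only [hd, hs]; exact_mod_cast (Nat.div_add_mod _ _).symm
    rw [hJ]
    ring
  have hQ : Tendsto (fun n => chooseRatio (i n) (s n) (d n)) atTop
      (𝓝 (Real.exp (-(|lam| ^ 2 / (2 * x))))) := by
    refine tendsto_chooseRatio hiTop hs1 ?_
    have h := (hdq.pow 2).div hiq (by positivity)
    rw [show (|lam| / 2) ^ 2 / (x / 2) = |lam| ^ 2 / (2 * x) by field_simp] at h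
    refine h.congr' ?_
    filter_upwards [hqpos] with n hn
    simp only [Pi.div_apply]
    field_simp
  have hisTop : Tendsto (fun n => i n + s n) atTop atTop :=
    tendsto_atTop_mono (fun n => Nat.le_add_right _ _) hiTop
  have hrp := tendsto_sqrt_mul_returnProb.comp hisTop
  have hsqrt : Tendsto (fun n => √(((i n + s n : ℕ) : ℝ) / q n ^ 2)) atTop (𝓝 √(x / 2)) := by
    refine Tendsto.sqrt ?_
    have h := hiq.add hsq2
    rw [add_zero] at h
    refine h.congr fun n => ?_
    push_cast
    ring
  have hlin : Tendsto (fun n => (2 * ((2 * i n + s n : ℕ) : ℝ) + 1) / q n ^ 2) atTop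
      (𝓝 (2 * x)) := by
    have h := (hkq.const_mul 2).add hinv2
    rw [add_zero] at h
    refine h.congr fun n => ?_
    ring
  -- The factors are (2k+1)/q² → 2x, the two binomial ratios, √(i+s) times the return probability →
  -- 1/√π, and √((i+s)/q²) → √(x/2) as divisor.
  have hall := ((((hlin.mul hR).mul hrp).div hsqrt (by positivity)).mul hQ).div_const 2
  have hlim : 2 * x * Real.exp (-x ^ 2) * (1 / √Real.pi) / √(x / 2) *
      Real.exp (-(|lam| ^ 2 / (2 * x))) / 2 =
      √2 / √Real.pi * (x ^ (1 / 2 : ℝ) * Real.exp (-x ^ 2 - |lam| ^ 2 / (2 * x))) := by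
    rw [← Real.sqrt_eq_rpow, sub_eq_add_neg, Real.exp_add, Real.sqrt_div hx.le]
    have h1 : √x * √x = x := Real.mul_self_sqrt hx.le
    have h2 : 0 < √x := Real.sqrt_pos.2 hx
    have h3 : 0 < √Real.pi := Real.sqrt_pos.2 Real.pi_pos
    field_simp
    linear_combination -h1
  rw [hlim] at hall
  refine hall.congr' ?_
  filter_upwards [hqpos, hisTop.eventually_gt_atTop 0] with n hn his
  have hpos : (0 : ℝ) < ((i n + s n : ℕ) : ℝ) := by exact_mod_cast his
  have hsp : 0 < √((i n + s n : ℕ) : ℝ) := Real.sqrt_pos.2 hpos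
  have hfold : meanAtDepth n (J n % 2) (J n / 2) ⌊q n ^ 2 / 2 * x⌋₊ =
    meanAtDepth n (s n) (d n) (i n) := rfl
  rw [hfold]
  simp only [Pi.div_apply, Function.comp, meanAtDepth]
  rw [Real.sqrt_div hpos.le, Real.sqrt_sq hn.le]
  field_simp

theorem tendsto_integral_normalizedCount (lam : ℝ) :
    Tendsto
      (fun n : ℕ => ∫ τ, normalizedCount n ⌊lam * (n : ℝ) ^ (1 / 4 : ℝ)⌋ τ ∂(treeLaw n)) atTop
      (𝓝 (√2 / √Real.pi *
        ∫ x in Set.Ioi (0 : ℝ), x ^ (1 / 2 : ℝ) * Real.exp (-x ^ 2 - |lam| ^ 2 / (2 * x)))) := by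
  rw [← integral_const_mul]
  have h := tendsto_integral_filter_of_dominated_convergence (μ := volume.restrict (Set.Ioi 0))
    (F := fun n : ℕ => scaledMean n (⌊lam * (n : ℝ) ^ (1 / 4 : ℝ)⌋.natAbs % 2)
      (⌊lam * (n : ℝ) ^ (1 / 4 : ℝ)⌋.natAbs / 2)) (l := atTop)
    (fun x : ℝ => (x + 2) * (Real.exp 2 * Real.exp (-(1 / 6) * x ^ 2)))
    (Eventually.of_forall fun n => (measurable_scaledMean _ _ _).aestronglyMeasurable)
    (by
      filter_upwards [eventually_gt_atTop 0] with n hn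
      refine (ae_restrict_iff' measurableSet_Ioi).2 (ae_of_all _ fun x hx => ?_)
      rw [Real.norm_of_nonneg (scaledMean_nonneg _ _ _ _)]
      exact scaledMean_le hn (by omega) _ hx)
    integrable_scaledMean_bound
    ((ae_restrict_iff' measurableSet_Ioi).2 (ae_of_all _ fun x hx => tendsto_scaledMean lam hx))
  refine h.congr' ?_
  filter_upwards [eventually_gt_atTop 0] with n hn
  exact (integral_normalizedCount_eq_integral_scaledMean hn _).symm
end EmbeddedTrees

-- The cosine-Gamma series

namespace EmbeddedTrees

theorem hasDerivAt_tsum_pow_div_factorial {γ : ℕ → ℝ}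
    (hγ : ∀ R : ℝ, Summable fun m : ℕ => R ^ m / (m.factorial : ℝ) * γ m) (x : ℝ) :
    HasDerivAt (fun y : ℝ => ∑' m : ℕ, y ^ m / (m.factorial : ℝ) * γ m)
      (∑' m : ℕ, x ^ m / (m.factorial : ℝ) * γ (m + 1)) x := by
  set R := |x| + 1 with hR
  have hR1 : 0 < R := by positivity
  have hu : Summable fun m : ℕ => ‖(m : ℝ) * R ^ (m - 1) / (m.factorial : ℝ) * γ m‖ := by
    -- Since m ≤ 2^m, the differentiated terms at R are dominated by R⁻¹ times the original ones at
    -- 2R.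
    have h := (hγ (2 * R)).norm
    refine Summable.of_nonneg_of_le (fun m => norm_nonneg _) (fun m => ?_) (h.mul_left R⁻¹)
    rw [norm_mul, norm_mul, ← mul_assoc]
    refine mul_le_mul_of_nonneg_right ?_ (norm_nonneg _)
    rw [Real.norm_of_nonneg (by positivity), Real.norm_of_nonneg (by positivity), ← mul_div_assoc]
    refine div_le_div_of_nonneg_right ?_ (by positivity)
    cases m with
    | zero => simp; positivity
    | succ m =>
      have h2 : ((m + 1 : ℕ) : ℝ) ≤ 2 ^ (m + 1) := by exact_mod_cast Nat.lt_two_pow_self.le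
      rw [mul_pow, Nat.add_sub_cancel, pow_succ R, inv_mul_eq_div, mul_comm (R ^ m) R,
        ← mul_assoc, mul_right_comm, mul_div_assoc, div_self hR1.ne', mul_one]
      gcongr
  have h := hasDerivAt_tsum_of_isPreconnected (t := Metric.ball (0 : ℝ) R)
    (g := fun (m : ℕ) (y : ℝ) => y ^ m / (m.factorial : ℝ) * γ m)
    (g' := fun (m : ℕ) (y : ℝ) => (m : ℝ) * y ^ (m - 1) / (m.factorial : ℝ) * γ m)
    (y₀ := 0) (y := x) hu Metric.isOpen_ball (convex_ball _ _).isPreconnected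
    (fun m y _ => ((hasDerivAt_pow m y).div_const _).mul_const _)
    (fun m y hy => by
      rw [mem_ball_zero_iff, Real.norm_eq_abs] at hy
      simp only [norm_mul, norm_div, norm_pow, Real.norm_eq_abs, abs_of_pos hR1]
      gcongr)
    (Metric.mem_ball_self hR1) (hγ 0)
    (by rw [mem_ball_zero_iff, Real.norm_eq_abs]; linarith)
  have hs : Summable fun m : ℕ => (m : ℝ) * x ^ (m - 1) / (m.factorial : ℝ) * γ m := by
    refine Summable.of_norm_bounded hu fun m => ?_
    simp only [norm_mul, norm_div, norm_pow, Real.norm_eq_abs, abs_of_pos hR1]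
    gcongr
    linarith
  rw [hs.tsum_eq_zero_add] at h
  simp only [Nat.cast_zero, zero_mul, zero_div, zero_add, Nat.add_sub_cancel] at h
  have he : ∀ m : ℕ, x ^ m / (m.factorial : ℝ) * γ (m + 1) =
      ((m + 1 : ℕ) : ℝ) * x ^ m / ((m + 1).factorial : ℝ) * γ (m + 1) := by
    intro m
    rw [Nat.factorial_succ]
    push_cast
    field_simp
  simp only [he]
  exact h

/-- Log-convexity of Γ at x + 1/4 = (3/4)x + (1/4)(x+1). -/
theorem Gamma_add_quarter_le {x : ℝ} (hx : 0 < x) :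
    Real.Gamma (x + 1 / 4) ≤ x ^ (1 / 4 : ℝ) * Real.Gamma x := by
  have h := Real.Gamma_mul_add_mul_le_rpow_Gamma_mul_rpow_Gamma (s := x) (t := x + 1) (a := 3 / 4)
    (b := 1 / 4) hx (by linarith) (by norm_num) (by norm_num) (by norm_num)
  have hG := Real.Gamma_pos_of_pos hx
  rw [Real.Gamma_add_one hx.ne', Real.mul_rpow hx.le hG.le] at h
  calc Real.Gamma (x + 1 / 4) = Real.Gamma (3 / 4 * x + 1 / 4 * (x + 1)) := by congr 1; ring
    _ ≤ _ := h
    _ = x ^ (1 / 4 : ℝ) * (Real.Gamma x ^ (3 / 4 : ℝ) * Real.Gamma x ^ (1 / 4 : ℝ)) := by ring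
    _ = _ := by rw [← Real.rpow_add hG]; norm_num

/-- Ratio test: one step costs |R|/(m+1) and gains at most ((m+p)/4)^(1/4), which is at most
(m+1)^(1/4) when p ≤ 4. -/
theorem summable_pow_div_factorial_mul_Gamma {p : ℝ} (hp : 0 < p) (hp4 : p ≤ 4) (R : ℝ) :
    Summable fun m : ℕ => R ^ m / (m.factorial : ℝ) * Real.Gamma ((m + p) / 4) := by
  have hlim : Tendsto (fun m : ℕ => |R| * ((m : ℝ) + 1) ^ (-(3 / 4) : ℝ)) atTop (𝓝 0) := by
    have h := (tendsto_rpow_neg_atTop (show (0 : ℝ) < 3 / 4 by norm_num)).comp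
      (tendsto_atTop_add_const_right _ (1 : ℝ) tendsto_natCast_atTop_atTop)
    simpa using h.const_mul |R|
  refine summable_of_ratio_norm_eventually_le (r := 1 / 2) (by norm_num) ?_
  filter_upwards [hlim.eventually (ge_mem_nhds (show (0 : ℝ) < 1 / 2 by norm_num))] with m hm
  have hx : 0 < ((m : ℝ) + p) / 4 := by positivity
  have hG := Real.Gamma_pos_of_pos hx
  have hx' : (((m + 1 : ℕ) : ℝ) + p) / 4 = (m + p) / 4 + 1 / 4 := by push_cast; ring
  have hG' : 0 < Real.Gamma ((m + p) / 4 + 1 / 4) := Real.Gamma_pos_of_pos (by positivity)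
  have hle : (((m : ℝ) + p) / 4) ^ (1 / 4 : ℝ) ≤ ((m : ℝ) + 1) ^ (1 / 4 : ℝ) := by
    refine Real.rpow_le_rpow hx.le ?_ (by norm_num)
    linarith [(Nat.cast_nonneg m : (0 : ℝ) ≤ m)]
  have hpow : ((m : ℝ) + 1) ^ (1 / 4 : ℝ) = ((m : ℝ) + 1) ^ (-(3 / 4) : ℝ) * (m + 1) := by
    rw [← Real.rpow_add_one (by positivity)]; norm_num
  rw [hx']
  simp only [norm_mul, norm_div, norm_pow, Real.norm_eq_abs, Nat.abs_cast, abs_of_pos hG,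
    abs_of_pos hG']
  rw [Nat.factorial_succ, pow_succ]
  push_cast
  calc |R| ^ m * |R| / (((m : ℝ) + 1) * m.factorial) * Real.Gamma ((m + p) / 4 + 1 / 4)
      ≤ |R| ^ m * |R| / (((m : ℝ) + 1) * m.factorial) *
        (((m : ℝ) + 1) ^ (-(3 / 4) : ℝ) * (m + 1) * Real.Gamma ((m + p) / 4)) := by
        gcongr
        rw [← hpow]
        exact (Gamma_add_quarter_le hx).trans (by gcongr)
    _ = (|R| * ((m : ℝ) + 1) ^ (-(3 / 4) : ℝ)) *
        (|R| ^ m / m.factorial * Real.Gamma ((m + p) / 4)) := by field_simp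
    _ ≤ _ := by gcongr

/-- The coefficients of the exponential generating functions in `cosGammaSeries`. -/
noncomputable def cosGammaCoeff (q : ℝ) (m : ℕ) : ℝ :=
  Real.cos ((m + q) * Real.pi / 4) * Real.Gamma ((m + (q + 2)) / 4)

/-- The entire functions that solve the differential system satisfied by the limiting profile. -/
noncomputable def cosGammaSeries (q a : ℝ) : ℝ :=
  ∑' m : ℕ, (-2 * a) ^ m / (m.factorial : ℝ) * cosGammaCoeff q m

theorem summable_cosGammaCoeff {q : ℝ} (hq : -2 < q) (hq2 : q ≤ 2) (R : ℝ) :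
    Summable fun m : ℕ => R ^ m / (m.factorial : ℝ) * cosGammaCoeff q m := by
  have h := (summable_pow_div_factorial_mul_Gamma (p := q + 2) (by linarith) (by linarith) R).norm
  refine Summable.of_norm_bounded h fun m => ?_
  rw [cosGammaCoeff, norm_mul, norm_mul, norm_mul]
  refine mul_le_mul_of_nonneg_left ?_ (norm_nonneg _)
  exact mul_le_of_le_one_left (norm_nonneg _) (Real.abs_cos_le_one _)

/-- The coefficients depend on m + q only, so the shift in m caused by differentiation is a shift in
q. -/
theorem hasDerivAt_cosGammaSeries {q : ℝ} (hq : -2 < q) (hq2 : q ≤ 2) (a : ℝ) :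
    HasDerivAt (cosGammaSeries q) (-2 * cosGammaSeries (q + 1) a) a := by
  have h := (hasDerivAt_tsum_pow_div_factorial (summable_cosGammaCoeff hq hq2) (-2 * a)).comp a
    ((hasDerivAt_id a).const_mul (-2))
  rw [mul_one, mul_comm] at h
  have he : cosGammaSeries (q + 1) a =
      ∑' m : ℕ, (-2 * a) ^ m / (m.factorial : ℝ) * cosGammaCoeff q (m + 1) := by
    refine tsum_congr fun m => ?_
    have e1 : ((m : ℝ) + (q + 1)) = ((m + 1 : ℕ) : ℝ) + q := by push_cast; ring
    have e2 : ((m : ℝ) + (q + 1 + 2)) = ((m + 1 : ℕ) : ℝ) + (q + 2) := by push_cast; ring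
    rw [cosGammaCoeff, cosGammaCoeff, e1, e2]
  rw [he]
  exact h

/-- This closes the differential system. The constant term dies because cos(π/2) = 0; in the others,
moving m by one turns the angle by π and raises the Gamma argument by one. -/
theorem cosGammaSeries_two (a : ℝ) : cosGammaSeries 2 a = a / 2 * cosGammaSeries (-1) a := by
  rw [cosGammaSeries, (summable_cosGammaCoeff (by norm_num) (by norm_num) _).tsum_eq_zero_add,
    cosGammaSeries, ← tsum_mul_left]
  have h0 : cosGammaCoeff 2 0 = 0 := by
    rw [cosGammaCoeff, show ((0 : ℕ) + 2 : ℝ) * Real.pi / 4 = Real.pi / 2 by push_cast; ring,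
      Real.cos_pi_div_two, zero_mul]
  rw [h0, mul_zero, zero_add]
  refine tsum_congr fun m => ?_
  have hm : ((m : ℝ) + 1) / 4 ≠ 0 := by positivity
  have e1 : (((m + 1 : ℕ) : ℝ) + 2) * Real.pi / 4 = (m + -1) * Real.pi / 4 + Real.pi := by
    push_cast; ring
  have e2 : (((m + 1 : ℕ) : ℝ) + (2 + 2)) / 4 = (m + 1) / 4 + 1 := by push_cast; ring
  have e3 : ((m : ℝ) + (-1 + 2)) / 4 = (m + 1) / 4 := by ring
  rw [cosGammaCoeff, cosGammaCoeff, e1, e2, e3, Real.cos_add_pi, Real.Gamma_add_one hm,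
    Nat.factorial_succ, pow_succ]
  push_cast
  field_simp
  ring

theorem cosGammaSeries_zero (q : ℝ) :
    cosGammaSeries q 0 = Real.cos (q * Real.pi / 4) * Real.Gamma ((q + 2) / 4) := by
  rw [cosGammaSeries, tsum_eq_single 0]
  · simp [cosGammaCoeff]
  · intro m hm
    simp [hm]

-- Uniqueness for the differential system

/-- Uniqueness for a linear system with continuous data at the left end point. -/
theorem eq_zero_of_linear_system {h k f : ℝ → ℝ} (hh : ContinuousOn h (Set.Ici 0))
    (hk : ContinuousOn k (Set.Ici 0)) (hf : ContinuousOn f (Set.Ici 0))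
    (hh' : ∀ a, 0 < a → HasDerivAt h (-k a) a) (hk' : ∀ a, 0 < a → HasDerivAt k (-2 * f a) a)
    (hf' : ∀ a, 0 < a → HasDerivAt f (-2 * a * h a) a)
    (h0 : h 0 = 0) (k0 : k 0 = 0) (f0 : f 0 = 0) {a : ℝ} (ha : 0 ≤ a) : f a = 0 := by
  -- The weight makes the energy h² + k² + f² nonincreasing on [0, a]: the cross terms cost at most
  -- (3 + 2a) times the energy.
  set C : ℝ := 5 + 2 * a with hC
  set E : ℝ → ℝ := fun t => Real.exp (-C * t) * (h t ^ 2 + k t ^ 2 + f t ^ 2) with hE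
  have hsub : Set.Icc 0 a ⊆ Set.Ici 0 := fun t ht => ht.1
  have hder : ∀ t, 0 < t → HasDerivAt E (Real.exp (-C * t) * (-C * 1) *
      (h t ^ 2 + k t ^ 2 + f t ^ 2) + Real.exp (-C * t) *
      (2 * h t ^ (2 - 1) * (-k t) + 2 * k t ^ (2 - 1) * (-2 * f t) +
        2 * f t ^ (2 - 1) * (-2 * t * h t))) t := by
    intro t ht
    have h1 := (((hh' t ht).pow 2).add ((hk' t ht).pow 2)).add ((hf' t ht).pow 2)
    exact (((hasDerivAt_id t).const_mul (-C)).exp).mul h1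
  have hanti : AntitoneOn E (Set.Icc 0 a) := by
    refine antitoneOn_of_deriv_nonpos (convex_Icc 0 a) ?_ ?_ ?_
    · refine ContinuousOn.mul (by fun_prop) ?_
      exact (((hh.mono hsub).pow 2).add ((hk.mono hsub).pow 2)).add ((hf.mono hsub).pow 2)
    · rw [interior_Icc]
      exact fun t ht => (hder t ht.1).differentiableAt.differentiableWithinAt
    · rw [interior_Icc]
      intro t ht
      rw [(hder t ht.1).deriv]
      have hexp := Real.exp_pos (-C * t)
      have key : -C * (h t ^ 2 + k t ^ 2 + f t ^ 2) + (2 * h t * (-k t) + 2 * k t * (-2 * f t) +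
          2 * f t * (-2 * t * h t)) ≤ 0 := by
        have h1 : -(2 * f t * h t) ≤ f t ^ 2 + h t ^ 2 := by nlinarith [sq_nonneg (f t + h t)]
        have h2 : t * (-(2 * f t * h t)) ≤ a * (f t ^ 2 + h t ^ 2) :=
          (mul_le_mul_of_nonneg_left h1 ht.1.le).trans
            (mul_le_mul_of_nonneg_right ht.2.le (by positivity))
        nlinarith [sq_nonneg (h t + k t), sq_nonneg (k t + f t), mul_nonneg ha (sq_nonneg (k t))]
      simp only [Nat.add_one_sub_one, pow_one, mul_one]
      nlinarith
  have hle := hanti (Set.left_mem_Icc.2 ha) (Set.right_mem_Icc.2 ha) ha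
  simp only [hE, h0, k0, f0] at hle
  have hexp := Real.exp_pos (-C * a)
  have h3 : h a ^ 2 + k a ^ 2 + f a ^ 2 ≤ 0 := by
    by_contra hcon
    have := mul_pos hexp (not_le.1 hcon)
    refine absurd hle (not_le.2 ?_)
    simpa using this
  have : f a ^ 2 = 0 := by nlinarith [sq_nonneg (h a), sq_nonneg (k a), sq_nonneg (f a)]
  exact pow_eq_zero_iff two_ne_zero |>.1 this
end EmbeddedTrees

-- The limiting integral and its differential system

namespace EmbeddedTrees

/-- Gaussian moments damped at the origin. -/
noncomputable def dampedMoment (s a : ℝ) : ℝ :=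
  ∫ x in Set.Ioi (0 : ℝ), x ^ s * Real.exp (-x ^ 2 - a ^ 2 / (2 * x))

/-- Gaussian integrals against a stable density of index one half. -/
noncomputable def stableMoment (s a : ℝ) : ℝ :=
  ∫ y in Set.Ioi (0 : ℝ), y ^ s * Real.exp (-(a ^ 4 * y ^ 2) - 1 / (2 * y))

theorem integrableOn_rpow_mul_exp_neg_sq {s : ℝ} (hs : -1 < s) :
    IntegrableOn (fun x : ℝ => x ^ s * Real.exp (-x ^ 2)) (Set.Ioi 0) := by
  simpa using integrableOn_rpow_mul_exp_neg_mul_sq one_pos hs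

theorem measurable_dampedMoment_integrand (s a : ℝ) :
    Measurable fun x : ℝ => x ^ s * Real.exp (-x ^ 2 - a ^ 2 / (2 * x)) := by fun_prop

theorem norm_dampedMoment_integrand_le (s a : ℝ) {x : ℝ} (hx : 0 < x) :
    ‖x ^ s * Real.exp (-x ^ 2 - a ^ 2 / (2 * x))‖ ≤ x ^ s * Real.exp (-x ^ 2) := by
  rw [Real.norm_of_nonneg (by positivity)]
  gcongr
  have : 0 ≤ a ^ 2 / (2 * x) := by positivity
  linarith

theorem continuous_dampedMoment {s : ℝ} (hs : -1 < s) : Continuous (dampedMoment s) := by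
  refine continuous_of_dominated
    (fun a => (measurable_dampedMoment_integrand s a).aestronglyMeasurable)
    (fun a => (ae_restrict_iff' measurableSet_Ioi).2
      (ae_of_all _ fun x hx => norm_dampedMoment_integrand_le s a hx))
    (integrableOn_rpow_mul_exp_neg_sq hs) (ae_of_all _ fun x => by fun_prop)

theorem exp_neg_le_inv {t : ℝ} (ht : 0 < t) : Real.exp (-t) ≤ t⁻¹ := by
  rw [Real.exp_neg]
  exact inv_anti₀ ht (by linarith [Real.add_one_le_exp t])

/-- Differentiation brings down b/x, singular at 0. The damping compensates: exp(-t) ≤ 1/t with t =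
b²/(2x) leaves (2/b) x^s exp(-x²), and b > a/2 makes this uniform. -/
theorem hasDerivAt_dampedMoment {s a : ℝ} (hs : -1 < s) (ha : 0 < a) :
    HasDerivAt (dampedMoment s) (-a * dampedMoment (s - 1) a) a := by
  have hmem : Set.Ioi (a / 2) ∈ 𝓝 a := Ioi_mem_nhds (by linarith)
  have h := (hasDerivAt_integral_of_dominated_loc_of_deriv_le
    (μ := volume.restrict (Set.Ioi (0 : ℝ))) (x₀ := a)
    (F := fun a x : ℝ => x ^ s * Real.exp (-x ^ 2 - a ^ 2 / (2 * x)))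
    (F' := fun b x : ℝ => x ^ s * (Real.exp (-x ^ 2 - b ^ 2 / (2 * x)) *
      (-((2 : ℕ) * b ^ (2 - 1) / (2 * x)))))
    (bound := fun x => 4 / a * (x ^ s * Real.exp (-x ^ 2))) hmem
    (Eventually.of_forall fun b => (measurable_dampedMoment_integrand s b).aestronglyMeasurable)
    (Integrable.mono' (integrableOn_rpow_mul_exp_neg_sq hs)
      (measurable_dampedMoment_integrand s a).aestronglyMeasurable
      ((ae_restrict_iff' measurableSet_Ioi).2
        (ae_of_all _ fun x hx => norm_dampedMoment_integrand_le s a hx)))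
    (Measurable.aestronglyMeasurable (by fun_prop))
    ((ae_restrict_iff' measurableSet_Ioi).2 (ae_of_all _ fun x hx b hb => ?_))
    ((integrableOn_rpow_mul_exp_neg_sq hs).const_mul _)
    (ae_of_all _ fun x b _ => ?_)).2
  · refine h.congr_deriv ?_
    rw [dampedMoment, ← integral_const_mul]
    refine setIntegral_congr_fun measurableSet_Ioi fun x hx => ?_
    have hx' : (0 : ℝ) < x := hx
    simp only [Nat.cast_ofNat, Nat.add_one_sub_one, pow_one]
    rw [Real.rpow_sub_one hx'.ne']
    field_simp
  · have hx' : (0 : ℝ) < x := hx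
    have hb' : a / 2 < b := hb
    have hb0 : 0 < b := by linarith
    have hexp : Real.exp (-(b ^ 2 / (2 * x))) ≤ (b ^ 2 / (2 * x))⁻¹ :=
      exp_neg_le_inv (by positivity)
    have hinv : 2 / b ≤ 4 / a := by rw [div_le_div_iff₀ hb0 ha]; linarith
    simp only [Nat.cast_ofNat, Nat.add_one_sub_one, pow_one]
    rw [norm_mul, norm_mul, norm_neg, Real.norm_of_nonneg (by positivity),
      Real.norm_of_nonneg (by positivity), Real.norm_of_nonneg (by positivity), sub_eq_add_neg,
      Real.exp_add]
    calc x ^ s * (Real.exp (-x ^ 2) * Real.exp (-(b ^ 2 / (2 * x))) * (2 * b / (2 * x)))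
        ≤ x ^ s * (Real.exp (-x ^ 2) * (b ^ 2 / (2 * x))⁻¹ * (2 * b / (2 * x))) := by gcongr
      _ = 2 / b * (x ^ s * Real.exp (-x ^ 2)) := by field_simp
      _ ≤ _ := by gcongr
  · have h1 := ((hasDerivAt_pow 2 b).div_const (2 * x)).const_sub (-x ^ 2)
    exact h1.exp.const_mul _

/-- The substitution y = x^(-2) turns the stable density of index one half into a Gaussian. -/
theorem rpow_two_mul_stable_comp {x : ℝ} (hx : 0 < x) :
    (|(-2 : ℝ)| * x ^ (-2 - 1 : ℝ)) •
      ((x ^ (-2 : ℝ)) ^ (-(3 / 2) : ℝ) * Real.exp (-(1 / (2 * x ^ (-2 : ℝ))))) =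
      2 * Real.exp (-(1 / 2) * x ^ 2) := by
  have h1 : (x ^ (-2 : ℝ)) ^ (-(3 / 2) : ℝ) = x ^ (3 : ℝ) := by
    rw [← Real.rpow_mul hx.le]; norm_num
  have h2 : x ^ (-2 : ℝ) = (x ^ 2)⁻¹ := by
    rw [Real.rpow_neg hx.le]; norm_num
  have h3 : x ^ (-2 - 1 : ℝ) * x ^ (3 : ℝ) = 1 := by
    rw [← Real.rpow_add hx]; norm_num
  rw [h1, h2, smul_eq_mul, abs_neg, abs_two]
  rw [show -(1 / (2 * (x ^ 2)⁻¹)) = -(1 / 2) * x ^ 2 by field_simp]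
  linear_combination 2 * Real.exp (-(1 / 2) * x ^ 2) * h3

theorem integrableOn_stable :
    IntegrableOn (fun y : ℝ => y ^ (-(3 / 2) : ℝ) * Real.exp (-(1 / (2 * y)))) (Set.Ioi 0) := by
  rw [← integrableOn_Ioi_comp_rpow_iff _ (show (-2 : ℝ) ≠ 0 by norm_num),
    integrableOn_congr_fun (fun x (hx : x ∈ Set.Ioi (0 : ℝ)) => rpow_two_mul_stable_comp hx)
      measurableSet_Ioi]
  exact ((integrable_exp_neg_mul_sq (by norm_num)).const_mul 2).integrableOn

theorem stableMoment_zero : stableMoment (-(3 / 2)) 0 = √2 * √Real.pi := by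
  have h : stableMoment (-(3 / 2)) 0 =
      ∫ y in Set.Ioi (0 : ℝ), y ^ (-(3 / 2) : ℝ) * Real.exp (-(1 / (2 * y))) := by
    simp [stableMoment]
  rw [h, ← integral_comp_rpow_Ioi _ (show (-2 : ℝ) ≠ 0 by norm_num),
    setIntegral_congr_fun measurableSet_Ioi (fun x hx => rpow_two_mul_stable_comp hx),
    integral_const_mul, integral_gaussian_Ioi, ← Real.sqrt_mul (by norm_num)]
  rw [show Real.pi / (1 / 2) = 2 * Real.pi by ring]
  ring

theorem measurable_stableMoment_integrand (s a : ℝ) :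
    Measurable fun y : ℝ => y ^ s * Real.exp (-(a ^ 4 * y ^ 2) - 1 / (2 * y)) := by fun_prop

theorem norm_stableMoment_integrand_le (s a : ℝ) {y : ℝ} (hy : 0 < y) :
    ‖y ^ s * Real.exp (-(a ^ 4 * y ^ 2) - 1 / (2 * y))‖ ≤ y ^ s * Real.exp (-(1 / (2 * y))) := by
  rw [Real.norm_of_nonneg (by positivity)]
  gcongr
  have : 0 ≤ a ^ 4 * y ^ 2 := by positivity
  linarith

theorem continuous_stableMoment : Continuous (stableMoment (-(3 / 2))) := by
  refine continuous_of_dominated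
    (fun a => (measurable_stableMoment_integrand _ a).aestronglyMeasurable)
    (fun a => (ae_restrict_iff' measurableSet_Ioi).2
      (ae_of_all _ fun x hx => norm_stableMoment_integrand_le _ a hx))
    integrableOn_stable (ae_of_all _ fun x => by fun_prop)

theorem hasDerivAt_stableMoment {a : ℝ} (ha : 0 < a) :
    HasDerivAt (stableMoment (-(3 / 2))) (-4 * a ^ 3 * stableMoment (1 / 2) a) a := by
  -- The lower end keeps the Gaussian decay in y, the upper end bounds b³.
  have hmem : Set.Ioo (a / 2) (2 * a) ∈ 𝓝 a := Ioo_mem_nhds (by linarith) (by linarith)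
  have hhalf : ∀ x : ℝ, 0 < x → x ^ (-(3 / 2) : ℝ) * x ^ 2 = x ^ (1 / 2 : ℝ) := fun x hx => by
    rw [← Real.rpow_natCast x 2, ← Real.rpow_add hx]; norm_num
  have h := (hasDerivAt_integral_of_dominated_loc_of_deriv_le
    (μ := volume.restrict (Set.Ioi (0 : ℝ))) (x₀ := a)
    (F := fun a y : ℝ => y ^ (-(3 / 2) : ℝ) * Real.exp (-(a ^ 4 * y ^ 2) - 1 / (2 * y)))
    (F' := fun b y : ℝ => y ^ (-(3 / 2) : ℝ) * (Real.exp (-(b ^ 4 * y ^ 2) - 1 / (2 * y)) *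
      (-((4 : ℕ) * b ^ (4 - 1) * y ^ 2))))
    (bound := fun y => 4 * (2 * a) ^ 3 * (y ^ (1 / 2 : ℝ) * Real.exp (-((a / 2) ^ 4) * y ^ 2)))
    hmem
    (Eventually.of_forall fun b => (measurable_stableMoment_integrand _ b).aestronglyMeasurable)
    (Integrable.mono' integrableOn_stable
      (measurable_stableMoment_integrand _ a).aestronglyMeasurable
      ((ae_restrict_iff' measurableSet_Ioi).2
        (ae_of_all _ fun x hx => norm_stableMoment_integrand_le _ a hx)))
    (Measurable.aestronglyMeasurable (by fun_prop))
    ((ae_restrict_iff' measurableSet_Ioi).2 (ae_of_all _ fun y hy b hb => ?_))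
    ((integrableOn_rpow_mul_exp_neg_mul_sq (by positivity) (by norm_num)).const_mul _)
    (ae_of_all _ fun y b _ => ?_)).2
  · refine h.congr_deriv ?_
    rw [stableMoment, ← integral_const_mul]
    refine setIntegral_congr_fun measurableSet_Ioi fun y hy => ?_
    simp only [Nat.cast_ofNat, Nat.add_one_sub_one]
    rw [← hhalf y hy]
    ring
  · have hy' : (0 : ℝ) < y := hy
    have hb0 : 0 < b := by linarith [hb.1]
    have hexp : Real.exp (-(b ^ 4 * y ^ 2) - 1 / (2 * y)) ≤ Real.exp (-((a / 2) ^ 4) * y ^ 2) := by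
      rw [Real.exp_le_exp]
      have h1 : (a / 2) ^ 4 * y ^ 2 ≤ b ^ 4 * y ^ 2 := by gcongr; exact hb.1.le
      have h2 : 0 ≤ 1 / (2 * y) := by positivity
      linarith
    simp only [Nat.cast_ofNat, Nat.add_one_sub_one]
    rw [norm_mul, norm_mul, norm_neg, Real.norm_of_nonneg (by positivity),
      Real.norm_of_nonneg (by positivity), Real.norm_of_nonneg (by positivity), ← hhalf y hy']
    calc y ^ (-(3 / 2) : ℝ) * (Real.exp (-(b ^ 4 * y ^ 2) - 1 / (2 * y)) * (4 * b ^ 3 * y ^ 2))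
        ≤ y ^ (-(3 / 2) : ℝ) * (Real.exp (-((a / 2) ^ 4) * y ^ 2) * (4 * (2 * a) ^ 3 * y ^ 2)) := by
          gcongr
          exact hb.2.le
      _ = _ := by ring
  · have h1 := (((hasDerivAt_pow 4 b).mul_const (y ^ 2)).neg).sub_const (1 / (2 * y))
    exact h1.exp.const_mul _

/-- Substitution x = a²y. At s = -3/2 the damped moment is not integrable at a = 0, whereas the
stable moment is continuous there and so provides an initial value. -/
theorem dampedMoment_eq_stableMoment (s : ℝ) {a : ℝ} (ha : 0 < a) :
    dampedMoment s a = (a ^ 2) ^ (s + 1) * stableMoment s a := by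
  have ha2 : 0 < a ^ 2 := by positivity
  have h := integral_comp_mul_left_Ioi
    (fun x : ℝ => x ^ s * Real.exp (-x ^ 2 - a ^ 2 / (2 * x))) 0 ha2
  rw [mul_zero, smul_eq_mul] at h
  have h' : ∫ x in Set.Ioi (0 : ℝ), (a ^ 2 * x) ^ s *
      Real.exp (-(a ^ 2 * x) ^ 2 - a ^ 2 / (2 * (a ^ 2 * x))) =
      (a ^ 2) ^ s * stableMoment s a := by
    rw [stableMoment, ← integral_const_mul]
    refine setIntegral_congr_fun measurableSet_Ioi fun x hx => ?_
    have hx' : (0 : ℝ) < x := hx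
    rw [Real.mul_rpow ha2.le hx'.le, mul_assoc,
      show -(a ^ 2 * x) ^ 2 - a ^ 2 / (2 * (a ^ 2 * x)) = -(a ^ 4 * x ^ 2) - 1 / (2 * x) by
        field_simp]
  rw [h'] at h
  rw [Real.rpow_add_one ha2.ne', mul_right_comm, h, dampedMoment, inv_mul_eq_div, div_mul_cancel₀ _ ha2.ne']

theorem dampedMoment_zero {s : ℝ} (hs : -1 < s) :
    dampedMoment s 0 = 1 / 2 * Real.Gamma ((s + 1) / 2) := by
  rw [← integral_rpow_mul_exp_neg_rpow two_pos hs, dampedMoment]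
  simp

theorem hasDerivAt_dampedMoment_neg_half {a : ℝ} (ha : 0 < a) :
    HasDerivAt (dampedMoment (-(1 / 2))) (-stableMoment (-(3 / 2)) a) a := by
  refine (hasDerivAt_dampedMoment (by norm_num) ha).congr_deriv ?_
  rw [show (-(1 / 2) - 1 : ℝ) = -(3 / 2) by norm_num, dampedMoment_eq_stableMoment _ ha,
    ← Real.rpow_natCast a 2, ← Real.rpow_mul ha.le,
    show ((2 : ℕ) : ℝ) * (-(3 / 2) + 1) = -1 by norm_num, Real.rpow_neg_one]
  field_simp

theorem hasDerivAt_stableMoment_eq_dampedMoment {a : ℝ} (ha : 0 < a) :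
    HasDerivAt (stableMoment (-(3 / 2))) (-4 * dampedMoment (1 / 2) a) a := by
  refine (hasDerivAt_stableMoment ha).congr_deriv ?_
  rw [dampedMoment_eq_stableMoment _ ha, ← Real.rpow_natCast a 2, ← Real.rpow_mul ha.le,
    show ((2 : ℕ) : ℝ) * (1 / 2 + 1) = (3 : ℕ) by norm_num, Real.rpow_natCast]
  ring

/-- The differences of moments and series, normalized to share one system, vanish at 0 and hence for
all a ≥ 0. At 0 the matching rests on cos(π/4) = √2/2 and Γ(1/2) = √π. -/
theorem dampedMoment_half_eq_cosGammaSeries {a : ℝ} (ha : 0 ≤ a) :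
    √2 / √Real.pi * dampedMoment (1 / 2) a = 1 / √Real.pi * cosGammaSeries 1 a := by
  have hp : 0 < √Real.pi := Real.sqrt_pos.2 Real.pi_pos
  have h2 : 0 < √(2 : ℝ) := Real.sqrt_pos.2 two_pos
  have h22 : √(2 : ℝ) * √2 = 2 := Real.mul_self_sqrt (by norm_num)
  have hA : ∀ q : ℝ, -2 < q → q ≤ 2 → Continuous (cosGammaSeries q) := fun q h1 h2 =>
    continuous_iff_continuousAt.2 fun x => (hasDerivAt_cosGammaSeries h1 h2 x).continuousAt
  have key := eq_zero_of_linear_system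
    (h := fun a => 1 / (√2 * √Real.pi) * dampedMoment (-(1 / 2)) a -
      1 / (2 * √Real.pi) * cosGammaSeries (-1) a)
    (k := fun a => 1 / (√2 * √Real.pi) * stableMoment (-(3 / 2)) a -
      1 / √Real.pi * cosGammaSeries 0 a)
    (f := fun a => √2 / √Real.pi * dampedMoment (1 / 2) a - 1 / √Real.pi * cosGammaSeries 1 a)
    (((continuous_dampedMoment (by norm_num)).const_mul _).sub
      ((hA _ (by norm_num) (by norm_num)).const_mul _)).continuousOn
    ((continuous_stableMoment.const_mul _).sub
      ((hA _ (by norm_num) (by norm_num)).const_mul _)).continuousOn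
    (((continuous_dampedMoment (by norm_num)).const_mul _).sub
      ((hA _ (by norm_num) (by norm_num)).const_mul _)).continuousOn
    (fun t ht => ?_) (fun t ht => ?_) (fun t ht => ?_) ?_ ?_ ?_ ha
  · linarith
  · refine (((hasDerivAt_dampedMoment_neg_half ht).const_mul _).sub
      ((hasDerivAt_cosGammaSeries (by norm_num) (by norm_num) t).const_mul _)).congr_deriv ?_
    rw [show (-1 + 1 : ℝ) = 0 by norm_num]
    field_simp
    ring
  · refine (((hasDerivAt_stableMoment_eq_dampedMoment ht).const_mul _).sub
      ((hasDerivAt_cosGammaSeries (by norm_num) (by norm_num) t).const_mul _)).congr_deriv ?_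
    rw [show (0 + 1 : ℝ) = 1 by norm_num]
    field_simp
    linear_combination 2 * dampedMoment (1 / 2) t * h22
  · refine (((hasDerivAt_dampedMoment (by norm_num) ht).const_mul _).sub
      ((hasDerivAt_cosGammaSeries (by norm_num) (by norm_num) t).const_mul _)).congr_deriv ?_
    rw [show (1 + 1 : ℝ) = 2 by norm_num, cosGammaSeries_two,
      show (1 / 2 - 1 : ℝ) = -(1 / 2) by norm_num]
    field_simp
    linear_combination -dampedMoment (-(1 / 2)) t * h22
  · rw [dampedMoment_zero (by norm_num), cosGammaSeries_zero,
      show (-1 * Real.pi / 4) = -(Real.pi / 4) by ring, Real.cos_neg, Real.cos_pi_div_four,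
      show ((-(1 / 2) + 1) / 2 : ℝ) = (-1 + 2) / 4 by norm_num]
    field_simp
    linear_combination -Real.Gamma ((-1 + 2) / 4) * h22
  · rw [stableMoment_zero, cosGammaSeries_zero, zero_mul, zero_div, Real.cos_zero,
      show ((0 + 2) / 4 : ℝ) = 1 / 2 by norm_num, Real.Gamma_one_half_eq]
    field_simp
    ring
  · rw [dampedMoment_zero (by norm_num), cosGammaSeries_zero,
      show (1 * Real.pi / 4) = (Real.pi / 4) by ring, Real.cos_pi_div_four,
      show ((1 / 2 + 1) / 2 : ℝ) = (1 + 2) / 4 by norm_num]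
    field_simp
    ring
end EmbeddedTrees

theorem proposition13 (lam : ℝ) :
    Summable (fun m : ℕ => (-2 * |lam|) ^ m / (m.factorial : ℝ) *
      Real.cos (((m : ℝ) + 1) * Real.pi / 4) * Real.Gamma (((m : ℝ) + 3) / 4)) ∧
    Tendsto
      (fun n : ℕ => ∫ τ, EmbeddedTrees.normalizedCount n ⌊lam * (n : ℝ) ^ (1 / 4 : ℝ)⌋ τ
        ∂(EmbeddedTrees.treeLaw n))
      atTop
      (𝓝 (1 / Real.sqrt Real.pi * ∑' m : ℕ, (-2 * |lam|) ^ m / (m.factorial : ℝ) *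
        Real.cos (((m : ℝ) + 1) * Real.pi / 4) * Real.Gamma (((m : ℝ) + 3) / 4))) := by
  have hterm : ∀ m : ℕ, (-2 * |lam|) ^ m / (m.factorial : ℝ) *
      Real.cos (((m : ℝ) + 1) * Real.pi / 4) * Real.Gamma (((m : ℝ) + 3) / 4) =
      (-2 * |lam|) ^ m / (m.factorial : ℝ) * EmbeddedTrees.cosGammaCoeff 1 m := by
    intro m
    rw [EmbeddedTrees.cosGammaCoeff, mul_assoc, show (1 + 2 : ℝ) = 3 by norm_num]
  simp only [hterm]
  refine ⟨EmbeddedTrees.summable_cosGammaCoeff (by norm_num) (by norm_num) _, ?_⟩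
  have h := EmbeddedTrees.tendsto_integral_normalizedCount lam
  have he := EmbeddedTrees.dampedMoment_half_eq_cosGammaSeries (abs_nonneg lam)
  rw [EmbeddedTrees.dampedMoment] at he
  rw [he] at h
  exact h
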